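/- Let $k$ be a constructive field of characteristic zero, that is, a field of characteristic zero given with a surjective numbering $\nu:\mathbb{N}\to k$ for which equality of the elements with given numbers is decidable and numbers of sums and products are computable from numbers of the arguments. Let $k\{x_1,\ldots,x_n\}$ be the ordinary differential polynomial algebra, that is, the polynomial algebra over $k$ in the independent variables $x_i^{(r)}$ ($1\le i\le n$, $r\ge 0$, $x_i=x_i^{(0)}$) with the $k$-linear derivation $f\mapsto f'$ determined by $(x_i^{(r)})'=x_i^{(r+1)}$. Represent the free Novikov algebra $N_0\langle x_1,\ldots,x_n\rangle$ without identity as the subspace of $k\{x_1,\ldots,x_n\}$ generated by $x_1,\ldots,x_n$ under linear combinations and the product $f\circ g=fg'$, and represent (the space of) the free Novikov algebra with identity as $N\langle x_1,\ldots,x_n\rangle=k\oplus N_0\langle x_1,\ldots,x_n\rangle\subset k\{x_1,\ldots,x_n\}$. Elements $f_1,\ldots,f_p\in N\langle x_1,\ldots,x_n\rangle$ are called Novikov dependent if there is a nonzero $h\in N\langle z_1,\ldots,z_p\rangle$ with $h(f_1,\ldots,f_p)=0$, where $h(f_1,\ldots,f_p)$ is obtained from the differential polynomial $h$ by replacing each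 $z_j^{(r)}$ with the $r$-th derivative of $f_j$. Then Novikov dependence of a finite system of elements of a free Novikov algebra over $k$ is algorithmically recognizable: there is an algorithm which, given $n$ and a finite list of elements $f_1,\ldots,f_p\in N\langle x_1,\ldots,x_n\rangle$ (each written as a finite sum of terms, a term being the number of its coefficient together with a product of variables $x_i^{(r)}$), decides whether $f_1,\ldots,f_p$ are Novikov dependent. -/

import Mathlib

open MvPolynomial

noncomputable section

/-- `ν : ℕ → k` is a constructivization of the field `k`: every element has a number, equality of
the elements with given numbers is decidable, and numbers of sums and of products are computed from
numbers of the arguments. (Numbers of `0`, `1`, of negatives and of inverses are then found by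
search.) A field is constructive if it is given with such a numbering. -/
structure IsConstructivization {k : Type*} [Field k] (ν : ℕ → k) : Prop where
  surjective : Function.Surjective ν
  eq_decidable : ComputablePred fun ab : ℕ × ℕ => ν ab.1 = ν ab.2
  add_computable : ∃ s : ℕ → ℕ → ℕ, Computable₂ s ∧ ∀ a b, ν (s a b) = ν a + ν b
  mul_computable : ∃ m : ℕ → ℕ → ℕ, Computable₂ m ∧ ∀ a b, ν (m a b) = ν a * ν b

/-- The ordinary differential polynomial algebra `k{x_1, …, x_n}`: polynomials in the independent
variables `x_i^{(r)}`, the variable `x_i^{(r)}` being `X (i, r)`. -/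
abbrev DiffPoly (k : Type*) [Field k] (n : ℕ) : Type _ := MvPolynomial (Fin n × ℕ) k

/-- The derivation `δ` of `k{x_1, …, x_n}`: it is zero on `k` and maps `x_i^{(r)}` to
`x_i^{(r+1)}`. -/
def diffD (k : Type*) [Field k] (n : ℕ) : Derivation k (DiffPoly k n) (DiffPoly k n) :=
  mkDerivation k fun v => X (v.1, v.2 + 1)

/-- The Novikov product `f ∘ g = f g'` on `k{x_1, …, x_n}`. -/
def novMul {k : Type*} [Field k] {n : ℕ} (f g : DiffPoly k n) : DiffPoly k n :=
  f * diffD k n g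

/-- The free Novikov algebra `N₀⟨x_1, …, x_n⟩` without identity: the subalgebra of
`(k{x_1, …, x_n}, ∘)` generated by `x_1, …, x_n`. -/
def freeNovikov₀ (k : Type*) [Field k] (n : ℕ) : Submodule k (DiffPoly k n) :=
  sInf {S | (∀ i : Fin n, X (i, 0) ∈ S) ∧ ∀ f ∈ S, ∀ g ∈ S, novMul f g ∈ S}

/-- The space of the free Novikov algebra `N⟨x_1, …, x_n⟩ = k ⊕ N₀⟨x_1, …, x_n⟩` with identity,
represented by differential polynomials. -/
def freeNovikov (k : Type*) [Field k] (n : ℕ) : Submodule k (DiffPoly k n) :=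
  Submodule.span k {1} ⊔ freeNovikov₀ k n

/-- The value `h(f_1, …, f_p)` of `h ∈ k{z_1, …, z_p}`: the variable `z_j^{(r)}` is replaced by the
`r`-th derivative of `f_j`. -/
def diffSubst {k : Type*} [Field k] {n p : ℕ} (f : Fin p → DiffPoly k n) (h : DiffPoly k p) :
    DiffPoly k n :=
  aeval (fun v : Fin p × ℕ => (diffD k n)^[v.2] (f v.1)) h

/-- Novikov dependence of `f_1, …, f_p`: some nonzero `h ∈ N⟨z_1, …, z_p⟩` satisfies
`h(f_1, …, f_p) = 0`. -/
def NovikovDependent {k : Type*} [Field k] {n p : ℕ} (f : Fin p → DiffPoly k n) : Prop :=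
  ∃ h ∈ freeNovikov k p, h ≠ 0 ∧ diffSubst f h = 0

/-- A written differential polynomial in `x_1, …, x_n`: a finite list of terms, each of which is a
number of its coefficient and a list of its factors, `(i, r)` standing for `x_i^{(r)}`. -/
abbrev DiffCode (n : ℕ) : Type := List (ℕ × List (Fin n × ℕ))

/-- The differential polynomial that a code denotes, with the coefficients numbered by `ν`. -/
def DiffCode.value {k : Type*} [Field k] (ν : ℕ → k) {n : ℕ} (c : DiffCode n) : DiffPoly k n :=
  (c.map fun t => C (ν t.1) * (t.2.map fun v => X v).prod).sum

/-- The same code as a plain finite object, in which `n` is no longer part of the type. -/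
def DiffCode.raw {n : ℕ} (c : DiffCode n) : List (ℕ × List (ℕ × ℕ)) :=
  c.map fun t => (t.1, t.2.map fun v => ((v.1 : ℕ), v.2))

end

/-! Novikov dependence coincides with differential algebraic dependence, and the latter is decidable
because both it and its negation have finite certificates.

Give `x_i^{(r)}` the weight `r - 1`. Then `N₀` is exactly the space of differential polynomials of
weight `-1` (`mem_freeNovikov₀_iff`). If the `f_j` in `N` are differentially dependent, so are their
derivatives, in which the constant summands have disappeared and which are homogeneous of weight 0.
A relation among them therefore has a nonzero homogeneous component that is again a relation, and a
power of some `z_j` brings its weight down to `-1` (`novikovDependent_iff`).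

Differential dependence is governed by the growth of the transcendence rank of the derivatives of
order less than `S`. In characteristic zero a derivation maps elements algebraic over `s` to
elements algebraic over `s` and its derivatives (`derivation_mem_cl`). Hence an element that is
differentially algebraic over `G` adds only a bounded amount to the rank, while any other element
adds `S`. A list is thus dependent iff some member is differentially algebraic over the later ones
(`not_dIndep_iff`). It is independent iff, for some `N`, it can be completed by indeterminates to a
list of length at most `N` over which the first `N` indeterminates are differentially algebraic
(`dIndep_univ_iff`).

Differential algebraicity is itself witnessed by finitely many coefficients of a polynomial, and
such a witness is checked by zero tests of written polynomials. Searching for both kinds of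
certificate gives the algorithm. -/

noncomputable section

namespace DiffDim

open Algebra (adjoin subset_adjoin adjoin_mono)

set_option linter.unusedSectionVars false

variable {k A : Type*} [Field k] [CommRing A] [IsDomain A] [Algebra k A]

/-! ### Algebraic closure and transcendence rank in a domain -/

variable (k) in
/-- Algebraic closure of a set in a domain over `k`, as a matroid closure. -/
abbrev cl (s : Set A) : Set A := (AlgebraicIndependent.matroid k A).closure s

variable (k) in
/-- Transcendence rank of a set in a domain over `k`. -/
abbrev rk (s : Set A) : ℕ∞ := (AlgebraicIndependent.matroid k A).eRk s

theorem mem_cl {s : Set A} {y : A} : y ∈ cl k s ↔ IsAlgebraic (adjoin k s) y := by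
  rw [cl, AlgebraicIndependent.matroid_closure_eq]; rfl

theorem subset_cl (s : Set A) : s ⊆ cl k s :=
  Matroid.subset_closure _ _ (by simp)

theorem cl_mono {s t : Set A} (h : s ⊆ t) : cl k s ⊆ cl k t :=
  Matroid.closure_subset_closure _ h

theorem cl_subset_cl {s t : Set A} (h : s ⊆ cl k t) : cl k s ⊆ cl k t :=
  Matroid.closure_subset_closure_of_subset_closure h

theorem rk_le_of_subset_cl {s t : Set A} (h : s ⊆ cl k t) : rk k s ≤ rk k t :=
  (Matroid.eRk_mono _ h).trans (Matroid.eRk_closure_eq _ _).le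

theorem rk_mono {s t : Set A} (h : s ⊆ t) : rk k s ≤ rk k t := Matroid.eRk_mono _ h

theorem rk_insert {s : Set A} {y : A} (h : y ∉ cl k s) : rk k (insert y s) = rk k s + 1 :=
  Matroid.eRk_insert_eq_add_one ⟨by simp, h⟩

theorem adjoin_subset_cl (s : Set A) : (adjoin k s : Set A) ⊆ cl k s := fun y hy =>
  mem_cl.2 (isAlgebraic_algebraMap (⟨y, hy⟩ : adjoin k s))

theorem isAlgebraic_iff_exists_polynomial {s : Set A} {y : A} :
    IsAlgebraic (adjoin k s) y ↔
      ∃ p : Polynomial A, p ≠ 0 ∧ (∀ i, p.coeff i ∈ adjoin k s) ∧ p.eval y = 0 := by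
  constructor
  · rintro ⟨p, hp, h⟩
    refine ⟨p.map (algebraMap _ A), ?_, fun i => ?_, ?_⟩
    · rwa [Ne, Polynomial.map_eq_zero_iff Subtype.val_injective]
    · rw [Polynomial.coeff_map]; exact (p.coeff i).2
    · rwa [Polynomial.eval_map_algebraMap]
  · rintro ⟨p, hp, hc, h⟩
    have hl : p ∈ Polynomial.lifts (algebraMap (adjoin k s) A) := by
      rw [Polynomial.lifts_iff_coeff_lifts]
      exact fun i => ⟨⟨_, hc i⟩, rfl⟩
    obtain ⟨q, rfl⟩ := hl
    refine ⟨q, ?_, by simpa [Polynomial.aeval_def, Polynomial.eval_map] using h⟩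
    rintro rfl
    simp at hp

/-- The chain rule for `p(y)`: `b` is the value at `y` of the polynomial obtained by differentiating
the coefficients of `p`. -/
theorem derivation_eval (D : Derivation k A A) (B : Subalgebra k A) (p : Polynomial A) (y : A)
    (hy : y ∈ B) (hp : ∀ i, D (p.coeff i) ∈ B) :
    ∃ b ∈ B, D (p.eval y) = b + p.derivative.eval y * D y := by
  refine ⟨∑ i ∈ Finset.range (p.natDegree + 1), D (p.coeff i) * y ^ i,
    B.sum_mem fun i _ => B.mul_mem (hp i) (B.pow_mem hy i), ?_⟩
  rw [Polynomial.eval_eq_sum_range, map_sum, Polynomial.derivative_eval,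
    Polynomial.sum_over_range _ (by simp), Finset.sum_mul, ← Finset.sum_add_distrib]
  refine Finset.sum_congr rfl fun i _ => ?_
  rw [Derivation.leibniz, Derivation.leibniz_pow]
  simp only [smul_eq_mul, nsmul_eq_mul]
  ring

/-- Differentiating an equation `p(y) = 0` of least degree gives an equation linear in `D y` whose
leading coefficient `p'(y)` is nonzero, by minimality and characteristic zero. All later rank
estimates rest on this. -/
theorem derivation_mem_cl [CharZero k] (D : Derivation k A A) {s : Set A} {y : A}
    (hy : y ∈ cl k s) : D y ∈ cl k (s ∪ D '' s) := by
  classical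
  have : CharZero A := charZero_of_injective_algebraMap (algebraMap k A).injective
  have hD : ∀ c ∈ adjoin k s, D c ∈ adjoin k (s ∪ D '' s) := by
    intro c hc
    induction hc using Algebra.adjoin_induction with
    | mem x hx => exact subset_adjoin (Or.inr ⟨x, hx, rfl⟩)
    | algebraMap r => simp
    | add x y _ _ hx hy => rw [map_add]; exact add_mem hx hy
    | mul x y hx' hy' hx hy =>
      have hs : adjoin k s ≤ adjoin k (s ∪ D '' s) := adjoin_mono Set.subset_union_left
      rw [Derivation.leibniz]
      exact add_mem (mul_mem (hs hx') hy) (mul_mem (hs hy') hx)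
  rw [mem_cl, isAlgebraic_iff_exists_polynomial] at hy
  have hex : ∃ d, ∃ p : Polynomial A, p.natDegree = d ∧ p ≠ 0 ∧ (∀ i, p.coeff i ∈ adjoin k s) ∧
      p.eval y = 0 := by
    obtain ⟨p, hp⟩ := hy
    exact ⟨_, p, rfl, hp⟩
  obtain ⟨p, hpd, hp0, hpc, hpy⟩ := Nat.find_spec hex
  have hmin := fun m => Nat.find_min hex (m := m)
  have hdeg : p.natDegree ≠ 0 := by
    intro h
    rw [Polynomial.eq_C_of_natDegree_eq_zero h, Polynomial.eval_C] at hpy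
    rw [Polynomial.eq_C_of_natDegree_eq_zero h, hpy] at hp0
    simp at hp0
  have hsep : p.derivative.eval y ≠ 0 := by
    intro h0
    refine hmin p.derivative.natDegree (hpd ▸ Polynomial.natDegree_derivative_lt hdeg)
      ⟨_, rfl, ?_, fun i => ?_, h0⟩
    · intro h
      exact hdeg (Polynomial.derivative_eq_zero.1 h)
    · rw [Polynomial.coeff_derivative]
      exact mul_mem (hpc _) (by exact_mod_cast natCast_mem (adjoin k s) (i + 1))
  set t := s ∪ D '' s
  obtain ⟨b, hb, hDe⟩ := derivation_eval D (adjoin k (insert y t)) p y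
    (subset_adjoin (Set.mem_insert _ _))
    (fun i => adjoin_mono (Set.subset_insert _ _) (hD _ (hpc i)))
  -- The coefficients of the linear equation for `D y` involve `y`; since `y` is algebraic over `s`,
  -- adjoining it does not enlarge the closure.
  have ht : cl k (insert y t) ⊆ cl k t := by
    refine cl_subset_cl (Set.insert_subset ?_ (subset_cl t))
    refine cl_mono Set.subset_union_left (mem_cl.2 ?_)
    exact isAlgebraic_iff_exists_polynomial.2 ⟨p, hp0, hpc, hpy⟩
  refine ht (mem_cl.2 (isAlgebraic_iff_exists_polynomial.2
    ⟨Polynomial.C (p.derivative.eval y) * Polynomial.X + Polynomial.C b, ?_, fun i => ?_, ?_⟩))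
  · intro h
    have := congrArg (fun q => Polynomial.coeff q 1) h
    simp [Polynomial.coeff_C] at this
    exact hsep this
  · have hs : s ⊆ insert y t := fun x hx => Or.inr (Or.inl hx)
    have h1 : p.derivative.eval y ∈ adjoin k (insert y t) := by
      rw [Polynomial.eval_eq_sum_range]
      refine sum_mem fun i _ => mul_mem ?_ (pow_mem (subset_adjoin (Set.mem_insert _ _)) i)
      rw [Polynomial.coeff_derivative]
      exact mul_mem (adjoin_mono hs (hpc _)) (by exact_mod_cast natCast_mem (adjoin k (insert y t)) (i + 1))
    rcases i with _ | _ | i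
    · simpa using hb
    · simpa [Polynomial.coeff_C] using h1
    · simp
  · rw [hpy, map_zero] at hDe
    simp only [Polynomial.eval_add, Polynomial.eval_mul, Polynomial.eval_C, Polynomial.eval_X]
    rw [hDe]; ring

/-! ### Growth of the rank of derivatives, and differential independence -/

/-- The derivatives of order less than `S` of the members of a list. -/
def derivs (D : Derivation k A A) (l : List A) (S : ℕ) : Set A :=
  {a | ∃ g ∈ l, ∃ s < S, D^[s] g = a}

/-- A list is differentially independent if its derivatives are algebraically independent, expressed
by the rank of the set of derivatives. -/
def DIndep (D : Derivation k A A) (l : List A) : Prop :=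
  ∀ S : ℕ, ((l.length * S : ℕ) : ℕ∞) ≤ rk k (derivs D l S)

/-- `y` is differentially algebraic over `G`. -/
def DAlg (D : Derivation k A A) (y : A) (G : List A) : Prop :=
  ∃ R M : ℕ, D^[R] y ∈ cl k (derivs D [y] R ∪ derivs D G M)

variable (D : Derivation k A A)

theorem derivs_append (l₁ l₂ : List A) (S : ℕ) :
    derivs D (l₁ ++ l₂) S = derivs D l₁ S ∪ derivs D l₂ S := by
  ext a
  simp [derivs, or_and_right, exists_or]

theorem derivs_cons (y : A) (G : List A) (S : ℕ) :
    derivs D (y :: G) S = derivs D [y] S ∪ derivs D G S := derivs_append D [y] G S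

theorem derivs_mono (l : List A) {S T : ℕ} (h : S ≤ T) : derivs D l S ⊆ derivs D l T := by
  rintro _ ⟨g, hg, s, hs, rfl⟩
  exact ⟨g, hg, s, hs.trans_le h, rfl⟩

theorem derivs_singleton_succ (y : A) (S : ℕ) :
    derivs D [y] (S + 1) = insert (D^[S] y) (derivs D [y] S) := by
  ext a
  simp only [derivs, List.mem_singleton, exists_eq_left, Set.mem_ofPred_eq, Set.mem_insert_iff,
    Nat.lt_succ_iff_lt_or_eq, or_and_right, exists_or]
  rw [or_comm]
  simp [eq_comm]

theorem image_derivs_subset (l : List A) (S : ℕ) : D '' derivs D l S ⊆ derivs D l (S + 1) := by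
  rintro _ ⟨_, ⟨g, hg, s, hs, rfl⟩, rfl⟩
  exact ⟨g, hg, s + 1, by omega, Function.iterate_succ_apply' _ _ _⟩

theorem encard_derivs_le (l : List A) (S : ℕ) :
    (derivs D l S).encard ≤ ((l.length * S : ℕ) : ℕ∞) := by
  induction l with
  | nil => simp [derivs]
  | cons y G ih =>
    have h1 : (derivs D [y] S).encard ≤ (S : ℕ∞) := by
      clear ih
      induction S with
      | zero => simp [derivs]
      | succ S ih =>
        rw [derivs_singleton_succ]
        refine (Set.encard_insert_le _ _).trans ?_
        push_cast
        gcongr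
    rw [derivs_cons]
    refine (Set.encard_union_le _ _).trans ((add_le_add h1 ih).trans ?_)
    rw [List.length_cons, ← Nat.cast_add]
    exact_mod_cast (by ring_nf; rfl)

theorem rk_derivs_le (l : List A) (S : ℕ) :
    rk k (derivs D l S) ≤ ((l.length * S : ℕ) : ℕ∞) :=
  (Matroid.eRk_le_encard _ _).trans (encard_derivs_le D l S)

variable {D}

/-- Repeated differentiation of the algebraic dependence of `D^[R] y` expresses every later
derivative of `y` through its first `R` ones, at the cost of one more order in `G` each time. -/
theorem derivs_subset_of_mem_cl [CharZero k] {y : A} {G : List A} {R M : ℕ}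
    (h : D^[R] y ∈ cl k (derivs D [y] R ∪ derivs D G M)) (t : ℕ) :
    derivs D [y] (R + t) ⊆ cl k (derivs D [y] R ∪ derivs D G (M + t)) := by
  have key : ∀ t, D^[R + t] y ∈ cl k (derivs D [y] R ∪ derivs D G (M + t)) ∧
      derivs D [y] (R + t) ⊆ cl k (derivs D [y] R ∪ derivs D G (M + t)) := by
    intro t
    induction t with
    | zero => exact ⟨h, Set.subset_union_left.trans (subset_cl _)⟩
    | succ t ih =>
      have hm : cl k (derivs D [y] R ∪ derivs D G (M + t)) ⊆
          cl k (derivs D [y] R ∪ derivs D G (M + (t + 1))) :=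
        cl_mono (Set.union_subset_union_right _ (derivs_mono D G (by omega)))
      have hsub : derivs D [y] (R + (t + 1)) ⊆
          cl k (derivs D [y] R ∪ derivs D G (M + (t + 1))) := by
        rw [← add_assoc, derivs_singleton_succ]
        exact Set.insert_subset (hm ih.1) (ih.2.trans hm)
      refine ⟨?_, hsub⟩
      rw [← add_assoc R, Function.iterate_succ_apply']
      refine cl_subset_cl ?_ (derivation_mem_cl D ih.1)
      rw [Set.image_union]
      refine Set.union_subset (Set.union_subset ?_ ?_) (Set.union_subset ?_ ?_)
      · exact Set.subset_union_left.trans (subset_cl _)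
      · exact (derivs_mono D G (by omega)).trans (Set.subset_union_right.trans (subset_cl _))
      · exact (image_derivs_subset D _ _).trans ((derivs_mono D _ (by omega)).trans hsub)
      · exact (image_derivs_subset D _ _).trans (Set.subset_union_right.trans (subset_cl _))
  exact (key t).2

theorem dIndep_nil : DIndep D [] := by simp [DIndep]

theorem DIndep.of_cons {y : A} {G : List A} (h : DIndep D (y :: G)) : DIndep D G := by
  intro S
  have h1 := h S
  rw [derivs_cons] at h1
  have h2 := h1.trans ((Matroid.eRk_union_le_eRk_add_eRk _ _ _).trans
    (add_le_add_left (rk_derivs_le D [y] S) _))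
  rw [List.length_cons, List.length_singleton, one_mul, add_mul, one_mul, add_comm,
    Nat.cast_add] at h2
  exact (ENat.add_le_add_iff_left (ENat.natCast_ne_top S)).1 h2

/-- Each new derivative of `y` lies outside the closure of the earlier ones together with
derivatives of `G`, so it raises the rank by one. -/
theorem DIndep.cons {y : A} {G : List A} (h : DIndep D G) (hy : ¬ DAlg D y G) :
    DIndep D (y :: G) := by
  intro S
  have key : ∀ t : ℕ, ((t + G.length * S : ℕ) : ℕ∞) ≤ rk k (derivs D [y] t ∪ derivs D G S) := by
    intro t
    induction t with
    | zero =>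
      rw [zero_add]
      exact (h S).trans (rk_mono Set.subset_union_right)
    | succ t ih =>
      have : D^[t] y ∉ cl k (derivs D [y] t ∪ derivs D G S) := fun hc => hy ⟨t, S, hc⟩
      rw [derivs_singleton_succ, Set.insert_union, rk_insert this, add_right_comm, Nat.cast_succ]
      gcongr
  rw [derivs_cons, List.length_cons, add_mul, one_mul, add_comm]
  exact key S

/-- Up to closure, only the first `R` derivatives of `y` and the derivatives of `G` of order less
than `M + S` matter; hence the constant `R + G.length * M`. -/
theorem DAlg.rk_le [CharZero k] {y : A} {G : List A} (h : DAlg D y G) :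
    ∃ c : ℕ, ∀ S : ℕ, rk k (derivs D (y :: G) S) ≤ ((G.length * S + c : ℕ) : ℕ∞) := by
  obtain ⟨R, M, h⟩ := h
  refine ⟨R + G.length * M, fun S => ?_⟩
  have h1 : derivs D (y :: G) S ⊆ cl k (derivs D [y] R ∪ derivs D G (M + S)) := by
    rw [derivs_cons]
    refine Set.union_subset ?_ ?_
    · exact (derivs_mono D _ (by omega)).trans (derivs_subset_of_mem_cl h S)
    · exact (derivs_mono D _ (by omega)).trans (Set.subset_union_right.trans (subset_cl _))
  refine (rk_le_of_subset_cl h1).trans ((Matroid.eRk_union_le_eRk_add_eRk _ _ _).trans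
    ((add_le_add (rk_derivs_le D _ _) (rk_derivs_le D _ _)).trans ?_))
  rw [← Nat.cast_add, List.length_singleton]
  exact_mod_cast (by ring_nf; rfl)

/-- A differentially dependent list has differential dimension less than its length. -/
theorem rk_le_of_not_dIndep [CharZero k] {l : List A} (h : ¬ DIndep D l) :
    ∃ c : ℕ, ∀ S : ℕ, rk k (derivs D l S) + (S : ℕ∞) ≤ ((l.length * S + c : ℕ) : ℕ∞) := by
  induction l with
  | nil => exact absurd dIndep_nil h
  | cons y G ih =>
    by_cases hG : DIndep D G
    · have hy : DAlg D y G := by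
        by_contra hy
        exact h (hG.cons hy)
      obtain ⟨c, hc⟩ := hy.rk_le
      refine ⟨c, fun S => (add_le_add_left (hc S) _).trans ?_⟩
      rw [← Nat.cast_add, List.length_cons]
      exact_mod_cast (by ring_nf; rfl)
    · obtain ⟨c, hc⟩ := ih hG
      refine ⟨c, fun S => ?_⟩
      rw [derivs_cons]
      calc rk k (derivs D [y] S ∪ derivs D G S) + (S : ℕ∞)
          ≤ rk k (derivs D [y] S) + rk k (derivs D G S) + S :=
            add_le_add_left (Matroid.eRk_union_le_eRk_add_eRk _ _ _) _
        _ ≤ (S : ℕ∞) + ((G.length * S + c : ℕ) : ℕ∞) := by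
            rw [add_assoc]
            refine add_le_add ?_ (hc S)
            simpa using rk_derivs_le D [y] S
        _ = _ := by
            rw [← Nat.cast_add, List.length_cons]
            congr 1; ring

/-- A lower bound on the growth of the rank proves independence. -/
theorem dIndep_of_le_rk [CharZero k] {l : List A} {c : ℕ}
    (h : ∀ S : ℕ, ((l.length * S : ℕ) : ℕ∞) ≤ rk k (derivs D l S) + c) : DIndep D l := by
  by_contra hl
  obtain ⟨d, hd⟩ := rk_le_of_not_dIndep hl
  -- Dependence costs `S` up to the constant `d`, and the hypothesis allows a loss of only `c`;
  -- these conflict once `S > c + d`.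
  have h1 : ((l.length * (c + d + 1) + (c + d + 1) : ℕ) : ℕ∞) ≤
      ((l.length * (c + d + 1) + d + c : ℕ) : ℕ∞) := by
    rw [Nat.cast_add, Nat.cast_add _ c]
    refine (add_le_add_left (h (c + d + 1)) _).trans ?_
    rw [add_right_comm]
    exact add_le_add_left (hd (c + d + 1)) _
  rw [Nat.cast_le] at h1
  omega

theorem dIndep_cons_iff [CharZero k] {y : A} {G : List A} :
    DIndep D (y :: G) ↔ DIndep D G ∧ ¬ DAlg D y G := by
  refine ⟨fun h => ⟨h.of_cons, fun hy => ?_⟩, fun h => h.1.cons h.2⟩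
  obtain ⟨c, hc⟩ := hy.rk_le
  have h1 := (h (c + 1)).trans (hc (c + 1))
  norm_cast at h1
  rw [List.length_cons, add_mul] at h1
  omega

/-- This makes dependence a search for one index and one proof of differential algebraicity. -/
theorem not_dIndep_iff [CharZero k] {l : List A} :
    ¬ DIndep D l ↔ ∃ i, ∃ h : i < l.length, DAlg D l[i] (l.drop (i + 1)) := by
  induction l with
  | nil => simp [dIndep_nil]
  | cons y G ih =>
    rw [dIndep_cons_iff, not_and_or, not_not, ih]
    constructor
    · rintro (⟨i, h, hi⟩ | h)
      · exact ⟨i + 1, by simpa using h, by simpa using hi⟩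
      · exact ⟨0, by simp, by simpa using h⟩
    · rintro ⟨_ | i, h, hi⟩
      · exact Or.inr (by simpa using hi)
      · exact Or.inl ⟨i, by simpa using h, by simpa using hi⟩

theorem derivs_map_subset (l : List A) (S : ℕ) :
    derivs D (l.map D) S ⊆ derivs D l (S + 1) := by
  rintro _ ⟨_, hg, s, hs, rfl⟩
  obtain ⟨g, hg', rfl⟩ := List.mem_map.1 hg
  exact ⟨g, hg', s + 1, by omega, rfl⟩

/-- Passing to derivatives shifts the order by one, which loses at most `l.length` in rank, and a
bounded loss is harmless. It is used contrapositively, to pass from dependent elements to their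
dependent derivatives. -/
theorem DIndep.of_map [CharZero k] {l : List A} (h : DIndep D (l.map D)) : DIndep D l := by
  refine dIndep_of_le_rk (c := l.length) fun S => ?_
  rcases S with _ | S
  · simp
  · rw [mul_add, mul_one, Nat.cast_add]
    gcongr
    have := h S
    rw [List.length_map] at this
    exact this.trans (rk_mono (derivs_map_subset l S))

/-- `Y` collects the finitely many low-order derivatives of the members of `xs`, and `M` is a shift
in `G` that serves all of them. -/
theorem derivs_subset_of_forall_dAlg [CharZero k] {G xs : List A} (h : ∀ x ∈ xs, DAlg D x G) :
    ∃ (c M : ℕ) (Y : Set A), Y.encard ≤ c ∧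
      ∀ S, derivs D xs S ⊆ cl k (Y ∪ derivs D G (M + S)) := by
  induction xs with
  | nil => exact ⟨0, 0, ∅, by simp, fun S => by simp [derivs]⟩
  | cons x xs ih =>
    obtain ⟨c, M, Y, hY, hc⟩ := ih fun y hy => h y (List.mem_cons_of_mem _ hy)
    obtain ⟨R, M', hx⟩ := h x List.mem_cons_self
    refine ⟨R + c, M' + M, derivs D [x] R ∪ Y, ?_, fun S => ?_⟩
    · refine (Set.encard_union_le _ _).trans ?_
      rw [Nat.cast_add]
      refine add_le_add ?_ hY
      simpa using encard_derivs_le D [x] R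
    · have hG : ∀ T ≤ M' + M + S, derivs D G T ⊆ derivs D G (M' + M + S) :=
        fun T hT => derivs_mono D G hT
      rw [derivs_cons]
      refine Set.union_subset ?_ ?_
      · refine ((derivs_mono D _ (by omega)).trans (derivs_subset_of_mem_cl hx S)).trans
          (cl_mono (Set.union_subset ?_ ?_))
        · exact Set.subset_union_left.trans Set.subset_union_left
        · exact (hG _ (by omega)).trans Set.subset_union_right
      · refine (hc S).trans (cl_mono (Set.union_subset ?_ ?_))
        · exact Set.subset_union_right.trans Set.subset_union_left
        · exact (hG _ (by omega)).trans Set.subset_union_right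

/-- A list over which an at least equally long independent list is differentially algebraic is
independent. -/
theorem DIndep.of_forall_dAlg [CharZero k] {G xs : List A} (hxs : DIndep D xs)
    (hlen : G.length ≤ xs.length) (h : ∀ x ∈ xs, DAlg D x G) : DIndep D G := by
  obtain ⟨c, M, Y, hY, hc⟩ := derivs_subset_of_forall_dAlg h
  refine dIndep_of_le_rk (c := c + G.length * M) fun S => ?_
  -- For `S = M + T` the rank at order `T` of `xs` is compared with that at order `M + T` of `G`.
  -- For `S < M` the constant alone suffices.
  rcases le_or_gt M S with hMS | hMS
  · obtain ⟨T, rfl⟩ := Nat.exists_eq_add_of_le hMS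
    have h1 := ((hxs T).trans (rk_le_of_subset_cl (hc T))).trans
      ((Matroid.eRk_union_le_encard_add_eRk _ _ _).trans (add_le_add_left hY _))
    have h2 : G.length * T ≤ xs.length * T := Nat.mul_le_mul_right _ hlen
    have h3 : ((G.length * T : ℕ) : ℕ∞) ≤ ((xs.length * T : ℕ) : ℕ∞) := by exact_mod_cast h2
    rw [mul_add, Nat.cast_add, Nat.cast_add, add_comm, ← add_assoc]
    refine add_le_add_left ((h3.trans h1).trans ?_) _
    rw [add_comm]
  · have : G.length * S ≤ c + G.length * M :=
      (Nat.mul_le_mul_left _ hMS.le).trans (Nat.le_add_left _ _)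
    exact (Nat.cast_le.2 this).trans le_add_self

theorem iterate_mem_cl [CharZero k] {xs : List A} {m : ℕ} {g : A} (hg : g ∈ cl k (derivs D xs m))
    (s : ℕ) : D^[s] g ∈ cl k (derivs D xs (m + s)) := by
  induction s with
  | zero => exact hg
  | succ s ih =>
    rw [Function.iterate_succ_apply']
    refine cl_mono ?_ (derivation_mem_cl D ih)
    exact Set.union_subset (derivs_mono D xs (by omega)) (image_derivs_subset D xs _)

/-- Comparison of growth rates: `G.length * S ≤ xs.length * (m + S)` for all `S`. The value `S =
xs.length * m + 1` is large enough to exclude `G.length > xs.length`. -/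
theorem DIndep.length_le [CharZero k] {xs G : List A} {m : ℕ} (hG : DIndep D G)
    (h : ∀ g ∈ G, g ∈ cl k (derivs D xs m)) : G.length ≤ xs.length := by
  have h1 : derivs D G (xs.length * m + 1) ⊆
      cl k (derivs D xs (m + (xs.length * m + 1))) := by
    rintro _ ⟨g, hg, s, hs, rfl⟩
    exact cl_mono (derivs_mono D xs (by omega)) (iterate_mem_cl (h g hg) s)
  have h2 := (hG _).trans ((rk_le_of_subset_cl h1).trans (rk_derivs_le D xs _))
  rw [Nat.cast_le] at h2
  by_contra! hlt
  have := Nat.mul_le_mul_right (xs.length * m + 1) (Nat.succ_le_of_lt hlt)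
  rw [Nat.succ_mul] at this
  nlinarith

/-- An independent list is completed by some of the generators to a list over which all the
generators are differentially algebraic. -/
theorem DIndep.exists_completion [CharZero k] {x : ℕ → A} {N m : ℕ} {G : List A}
    (hG : DIndep D G) (h : ∀ g ∈ G, g ∈ cl k (derivs D ((List.range N).map x) m)) :
    ∃ I : List ℕ, I.length + G.length ≤ N ∧ ∀ j < N, DAlg D (x j) (I.map x ++ G) := by
  classical
  have hlen : ∀ I : List ℕ, (∀ i ∈ I, i < N) → DIndep D (I.map x ++ G) →
      I.length + G.length ≤ N := by
    intro I hI hd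
    -- With `m + 1` in place of `m`, the generators themselves are among the derivatives even when
    -- `m = 0`.
    have := hd.length_le (xs := (List.range N).map x) (m := m + 1) (by
      intro g hg
      rcases List.mem_append.1 hg with hg | hg
      · obtain ⟨i, hi, rfl⟩ := List.mem_map.1 hg
        exact subset_cl _ ⟨x i, List.mem_map.2 ⟨i, List.mem_range.2 (hI i hi), rfl⟩, 0, by omega,
          rfl⟩
      · exact cl_mono (derivs_mono D _ (by omega)) (h g hg))
    simpa using this
  -- A longest independent completion is obtained by minimising the deficit `n`; a generator not
  -- differentially algebraic over it could be added to lower the deficit.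
  have hP : ∃ n, ∃ I : List ℕ, (∀ i ∈ I, i < N) ∧ DIndep D (I.map x ++ G) ∧ N ≤ I.length + n :=
    ⟨N, [], by simp, by simpa using hG, by simp⟩
  obtain ⟨I, hI, hd, hn⟩ := Nat.find_spec hP
  refine ⟨I, hlen I hI hd, fun j hj => ?_⟩
  by_contra hj'
  have hd' : DIndep D ((j :: I).map x ++ G) := hd.cons hj'
  have hI' : ∀ i ∈ j :: I, i < N := by
    simpa [hj] using hI
  have hl := hlen _ hI' hd'
  rw [List.length_cons] at hl
  refine Nat.find_min hP (m := Nat.find hP - 1) ?_ ⟨j :: I, hI', hd', ?_⟩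
  · omega
  · rw [List.length_cons]; omega

theorem derivs_eq_image (l : List A) (S : ℕ) :
    derivs D l S =
      (fun v : Fin l.length × ℕ => D^[v.2] (l.get v.1)) '' (Set.univ ×ˢ Set.Iio S) := by
  ext a
  constructor
  · rintro ⟨g, hg, s, hs, rfl⟩
    obtain ⟨i, rfl⟩ := List.get_of_mem hg
    exact ⟨(i, s), ⟨trivial, hs⟩, rfl⟩
  · rintro ⟨⟨i, s⟩, ⟨-, hs⟩, rfl⟩
    exact ⟨_, l.get_mem i, s, hs, rfl⟩

/-- A set of at most `l.length * S` elements whose rank is at least that number has no coincidences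
and is independent. The full family is the directed union of these sets. -/
theorem dIndep_iff_algebraicIndependent (l : List A) :
    DIndep D l ↔
      AlgebraicIndependent k (fun v : Fin l.length × ℕ => D^[v.2] (l.get v.1)) := by
  set v := fun v : Fin l.length × ℕ => D^[v.2] (l.get v.1) with hv
  have hcard : ∀ S : ℕ, ((Set.univ : Set (Fin l.length)) ×ˢ Set.Iio S).encard =
      ((l.length * S : ℕ) : ℕ∞) := by
    intro S
    rw [Set.encard_prod, Set.encard_univ, Nat.cast_mul, ← Finset.coe_Iio,
      Set.encard_coe_eq_coe_finsetCard, Nat.card_Iio]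
    simp
  constructor
  · intro h
    have hrk : ∀ S, (derivs D l S).encard ≤ rk k (derivs D l S) :=
      fun S => (encard_derivs_le D l S).trans (h S)
    have hinj : Function.Injective v := by
      rintro ⟨i, r⟩ ⟨j, s⟩ hij
      have hS : ∀ S, Set.InjOn v (Set.univ ×ˢ Set.Iio S) := fun S => by
        refine (Set.Finite.prod Set.finite_univ (Set.finite_Iio S)).injOn_of_encard_image_eq ?_
        rw [hcard, ← derivs_eq_image]
        exact le_antisymm (encard_derivs_le D l S)
          ((h S).trans (Matroid.eRk_le_encard _ _))
      exact hS (r + s + 1) ⟨trivial, by simp⟩ ⟨trivial, by simp⟩ hij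
    rw [← algebraicIndependent_subtype_range hinj]
    have hU : Set.range v = ⋃ S, derivs D l S := by
      ext a
      simp only [derivs_eq_image, Set.mem_range, Set.mem_iUnion]
      constructor
      · rintro ⟨⟨i, r⟩, rfl⟩
        exact ⟨r + 1, (i, r), ⟨trivial, by simp⟩, rfl⟩
      · rintro ⟨S, x, -, rfl⟩
        exact ⟨x, rfl⟩
    rw [hU]
    refine algebraicIndependent_iUnion_of_directed ?_ fun S => ?_
    · exact directed_of_isDirected_le fun S T h => derivs_mono D l h
    · refine AlgebraicIndependent.matroid_indep_iff.1
        (Matroid.IsRkFinite.indep_of_encard_le_eRk ?_ (hrk S))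
      rw [← Matroid.eRk_lt_top_iff]
      exact (rk_derivs_le D l S).trans_lt (ENat.natCast_lt_top _)
  · intro h S
    have hind : (AlgebraicIndependent.matroid k A).Indep (derivs D l S) := by
      refine Matroid.Indep.subset (AlgebraicIndependent.matroid_indep_iff.2
        ((algebraicIndependent_subtype_range h.injective).2 h)) ?_
      rw [derivs_eq_image]
      exact Set.image_subset_range _ _
    rw [rk, hind.eRk_eq_encard, derivs_eq_image, h.injective.injOn.encard_image, hcard]

end DiffDim
end

noncomputable section

set_option linter.unusedSectionVars false

namespace DiffDim

variable {k A : Type*} [Field k] [CommRing A] [IsDomain A] [Algebra k A] {D : Derivation k A A}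

theorem dIndep_ofFn {p : ℕ} (f : Fin p → A) :
    DIndep D (List.ofFn f) ↔
      AlgebraicIndependent k (fun v : Fin p × ℕ => D^[v.2] (f v.1)) := by
  rw [dIndep_iff_algebraicIndependent]
  refine algebraicIndependent_equiv'
    ((finCongr (List.length_ofFn (f := f))).prodCongr (Equiv.refl ℕ)) ?_
  ext ⟨i, r⟩
  simp
  rfl

end DiffDim

/-! ### The free Novikov algebra as the part of weight -1 -/

namespace Novikov

variable {k : Type*} [Field k] {n : ℕ}

/-- The weight `r - 1` of the variable `x_i^{(r)}`. -/
def wt (n : ℕ) (v : Fin n × ℕ) : ℤ := (v.2 : ℤ) - 1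

theorem diffD_X (v : Fin n × ℕ) : diffD k n (X v) = X (v.1, v.2 + 1) :=
  mkDerivation_X _ _ _

theorem X_mem_freeNovikov₀ (i : Fin n) : (X (i, 0) : DiffPoly k n) ∈ freeNovikov₀ k n :=
  Submodule.mem_sInf.2 fun _ hS => hS.1 i

theorem novMul_mem_freeNovikov₀ {f g : DiffPoly k n} (hf : f ∈ freeNovikov₀ k n)
    (hg : g ∈ freeNovikov₀ k n) : novMul f g ∈ freeNovikov₀ k n :=
  Submodule.mem_sInf.2 fun S hS =>
    hS.2 f (Submodule.mem_sInf.1 hf S hS) g (Submodule.mem_sInf.1 hg S hS)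

/-- The monomial with the given multiset of factors. -/
def mon (k : Type*) [Field k] {σ : Type*} (M : Multiset σ) : MvPolynomial σ k :=
  (M.map fun v => X v).prod

@[simp] theorem mon_zero {σ : Type*} : mon k (0 : Multiset σ) = 1 := by simp [mon]

@[simp] theorem mon_cons {σ : Type*} (v : σ) (M : Multiset σ) :
    mon k (v ::ₘ M) = X v * mon k M := by simp [mon]

@[simp] theorem mon_add {σ : Type*} (M N : Multiset σ) :
    mon k (M + N) = mon k M * mon k N := by simp [mon]

theorem mon_eq_monomial {σ : Type*} [DecidableEq σ] (M : Multiset σ) :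
    mon k M = monomial (Multiset.toFinsupp M) 1 := by
  induction M using Multiset.induction_on with
  | empty => simp
  | cons v M ih =>
    rw [mon_cons, ih, ← Multiset.singleton_add, map_add, Multiset.toFinsupp_singleton, X,
      monomial_mul, one_mul]

theorem weight_toFinsupp (w : Fin n × ℕ → ℤ) (M : Multiset (Fin n × ℕ)) :
    Finsupp.weight w (Multiset.toFinsupp M) = (M.map w).sum := by
  induction M using Multiset.induction_on with
  | empty => simp
  | cons v M ih =>
    rw [← Multiset.singleton_add, map_add, Multiset.toFinsupp_singleton, map_add, ih]
    simp [Finsupp.weight_single]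

theorem isWeightedHomogeneous_mon (M : Multiset (Fin n × ℕ)) :
    IsWeightedHomogeneous (wt n) (mon k M) (M.map (wt n)).sum := by
  rw [mon_eq_monomial]
  exact isWeightedHomogeneous_monomial _ _ _ (weight_toFinsupp _ _)

theorem mem_span_mon {f : DiffPoly k n} {m : ℤ} (hf : IsWeightedHomogeneous (wt n) f m) :
    f ∈ Submodule.span k {g | ∃ M : Multiset (Fin n × ℕ), (M.map (wt n)).sum = m ∧ mon k M = g} := by
  rw [f.as_sum]
  refine Submodule.sum_mem _ fun d hd => ?_
  have h1 : monomial d (coeff d f) = coeff d f • mon k (Finsupp.toMultiset d) := by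
    rw [mon_eq_monomial, Finsupp.toMultiset_toFinsupp, smul_monomial, smul_eq_mul, mul_one]
  rw [h1]
  refine Submodule.smul_mem _ _ (Submodule.subset_span ⟨_, ?_, rfl⟩)
  rw [← weight_toFinsupp, Finsupp.toMultiset_toFinsupp]
  exact hf (mem_support_iff.1 hd)

theorem isWeightedHomogeneous_diffD_mon (M : Multiset (Fin n × ℕ)) :
    IsWeightedHomogeneous (wt n) (diffD k n (mon k M)) ((M.map (wt n)).sum + 1) := by
  induction M using Multiset.induction_on with
  | empty => simpa using isWeightedHomogeneous_zero _ _ _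
  | cons v M ih =>
    rw [mon_cons, Derivation.leibniz, diffD_X, smul_eq_mul, smul_eq_mul, Multiset.map_cons,
      Multiset.sum_cons]
    refine IsWeightedHomogeneous.add ?_ ?_
    · rw [add_assoc]
      exact (isWeightedHomogeneous_X _ _ _).mul ih
    · have h := (isWeightedHomogeneous_mon (k := k) M).mul
        (isWeightedHomogeneous_X k (wt n) (v.1, v.2 + 1))
      convert h using 1
      simp only [wt]; push_cast; ring

theorem isWeightedHomogeneous_diffD {f : DiffPoly k n} {m : ℤ}
    (hf : IsWeightedHomogeneous (wt n) f m) :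
    IsWeightedHomogeneous (wt n) (diffD k n f) (m + 1) := by
  rw [← mem_weightedHomogeneousSubmodule]
  have hs := mem_span_mon hf
  clear hf
  induction hs using Submodule.span_induction with
  | mem x hx =>
    obtain ⟨M, rfl, rfl⟩ := hx
    exact isWeightedHomogeneous_diffD_mon M
  | zero => simp
  | add x y _ _ hx hy => rw [map_add]; exact add_mem hx hy
  | smul a x _ hx => rw [Derivation.map_smul]; exact Submodule.smul_mem _ _ hx

/-- Weights add under multiplication and the derivation raises weight by one, so `f g'` has weight
`-1 + (-1 + 1)`. -/
theorem freeNovikov₀_le :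
    freeNovikov₀ k n ≤ weightedHomogeneousSubmodule k (wt n) (-1) := by
  refine sInf_le ⟨fun i => ?_, fun f hf g hg => ?_⟩
  · rw [mem_weightedHomogeneousSubmodule]
    exact isWeightedHomogeneous_X k (wt n) (i, 0)
  · exact IsWeightedHomogeneous.mul hf (isWeightedHomogeneous_diffD hg)

/-- The Leibniz rule replaces one factor of the monomial at a time by its derivative. The cofactor
`u` is there to absorb factors during the induction. -/
theorem mul_diffD_mon_mem {S : Submodule k (DiffPoly k n)} {Z : Multiset (Fin n × ℕ)}
    {u : DiffPoly k n}
    (h : ∀ a ∈ Z, u * (mon k (Z.erase a) * X (a.1, a.2 + 1)) ∈ S) :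
    u * diffD k n (mon k Z) ∈ S := by
  classical
  induction Z using Multiset.induction_on generalizing u with
  | empty => simp
  | cons v Z ih =>
    rw [mon_cons, Derivation.leibniz, diffD_X, smul_eq_mul, smul_eq_mul, mul_add]
    refine add_mem ?_ ?_
    · rw [← mul_assoc]
      refine ih fun a ha => ?_
      have := h a (Multiset.mem_cons_of_mem ha)
      by_cases hav : a = v
      · subst hav
        rw [Multiset.erase_cons_head] at this
        rw [← mul_assoc, mul_assoc u, ← mon_cons, Multiset.cons_erase ha, mul_assoc]
        exact this
      · rw [Multiset.erase_cons_tail _ (Ne.symm hav), mon_cons] at this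
        rw [mul_assoc, ← mul_assoc (X v)]
        exact this
    · simpa using h v (Multiset.mem_cons_self v Z)

theorem exists_le_card_eq {α : Type*} {s : Multiset α} {m : ℕ} (h : m ≤ s.card) :
    ∃ t ≤ s, t.card = m := by
  have : 0 < (Multiset.powersetCard m s).card := by
    rw [Multiset.card_powersetCard]; exact Nat.choose_pos h
  obtain ⟨t, ht⟩ := Multiset.card_pos_iff_exists_mem.1 this
  exact ⟨t, Multiset.mem_powersetCard.1 ht⟩

/-- Only factors of order zero have negative weight, namely `-1`. This supplies enough of them in
the decomposition of a monomial of weight `-1`. -/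
theorem neg_card_le_sum_wt (M : Multiset (Fin n × ℕ)) :
    -((M.filter fun v => v.2 = 0).card : ℤ) ≤ (M.map (wt n)).sum := by
  induction M using Multiset.induction_on with
  | empty => simp
  | cons v M ih =>
    by_cases hv : v.2 = 0
    · rw [Multiset.filter_cons_of_pos (p := fun v : Fin n × ℕ => v.2 = 0) _ hv, Multiset.card_cons, Multiset.map_cons,
        Multiset.sum_cons]
      simp only [wt, hv]; push_cast; linarith
    · rw [Multiset.filter_cons_of_neg (p := fun v : Fin n × ℕ => v.2 = 0) _ hv, Multiset.map_cons, Multiset.sum_cons]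
      have : 0 ≤ wt n v := by simp only [wt]; omega
      linarith

theorem sum_wt_of_forall {Z : Multiset (Fin n × ℕ)} (h : ∀ v ∈ Z, v.2 = 0) :
    (Z.map (wt n)).sum = -(Z.card : ℤ) := by
  rw [Multiset.map_congr rfl (g := fun _ => (-1 : ℤ)) fun v hv => by simp [wt, h v hv]]
  simp

/-- The monomials of weight `-1` belong to the free Novikov algebra. -/
theorem mon_mem_freeNovikov₀ (M : Multiset (Fin n × ℕ)) (hM : (M.map (wt n)).sum = -1) :
    mon k M ∈ freeNovikov₀ k n := by
  classical
  induction hc : M.card using Nat.strong_induction_on generalizing M with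
  | _ c ih =>
  -- A factor of order one splits off, since `N ∘ x_i = N x_i'`.
  have hone : ∀ N : Multiset (Fin n × ℕ), ∀ i : Fin n, (N.map (wt n)).sum = -1 → N.card < c →
      mon k N * X (i, 1) ∈ freeNovikov₀ k n := by
    intro N i hN hNc
    have := novMul_mem_freeNovikov₀ (ih _ hNc N hN rfl) (X_mem_freeNovikov₀ (k := k) i)
    rwa [novMul, diffD_X] at this
  by_cases h1 : ∃ v ∈ M, v.2 = 1
  · obtain ⟨⟨i, r⟩, hv, rfl : r = 1⟩ := h1
    obtain ⟨N, rfl⟩ := Multiset.exists_cons_of_mem hv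
    rw [mon_cons, mul_comm]
    refine hone N i ?_ ?_
    · simpa [wt] using hM
    · rw [← hc, Multiset.card_cons]; omega
  by_cases h0 : ∀ v ∈ M, v.2 = 0
  · rw [sum_wt_of_forall h0] at hM
    have hcard : M.card = 1 := by omega
    obtain ⟨⟨i, r⟩, rfl⟩ := Multiset.card_eq_one.1 hcard
    obtain rfl : r = 0 := h0 (i, r) (Multiset.mem_singleton_self _)
    simpa [mon] using X_mem_freeNovikov₀ (k := k) i
  push Not at h0 h1
  obtain ⟨⟨i, s⟩, hv, hs⟩ := h0
  have hs1 := h1 _ hv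
  obtain ⟨r, rfl⟩ : ∃ r, s = r + 2 := ⟨s - 2, by simp only at hs hs1; omega⟩
  obtain ⟨N, rfl⟩ := Multiset.exists_cons_of_mem hv
  have hN : (N.map (wt n)).sum = -(r + 2 : ℤ) := by
    rw [Multiset.map_cons, Multiset.sum_cons] at hM
    simp only [wt] at hM ⊢; push_cast at hM; linarith
  have hle := neg_card_le_sum_wt N
  -- The monomial is `x_i^{(r+2)} N` with `N` of weight `-(r+2)`. Splitting `r + 1` factors of order
  -- zero off `N` as `Z` leaves `Q` of weight `-1`, and `x_i^{(r+1)} Z` has weight `-1` too.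
  obtain ⟨Z, hZle, hZc⟩ := exists_le_card_eq (s := N.filter fun v => v.2 = 0)
    (m := r + 1) (by omega)
  have hZ0 : ∀ v ∈ Z, v.2 = 0 := fun v hv =>
    (Multiset.mem_filter.1 (Multiset.mem_of_le hZle hv)).2
  obtain ⟨Q, rfl⟩ := Multiset.le_iff_exists_add.1 (hZle.trans (Multiset.filter_le _ _))
  have hZw := sum_wt_of_forall hZ0
  have hQ : (Q.map (wt n)).sum = -1 := by
    rw [Multiset.map_add, Multiset.sum_add, hZw, hZc] at hN
    push_cast at hN; linarith
  have hQc : 0 < Q.card := by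
    rw [Multiset.card_pos]; rintro rfl; simp at hQ
  rw [Multiset.card_cons, Multiset.card_add] at hc
  have hB := ih (m := Z.card + 1) (by omega) ((i, r + 1) ::ₘ Z)
    (by rw [Multiset.map_cons, Multiset.sum_cons, hZw, hZc]; simp only [wt]; push_cast; ring)
    (by simp)
  have hprod := novMul_mem_freeNovikov₀ (ih (m := Q.card) (by omega) Q hQ rfl) hB
  -- In `Q ∘ (x_i^{(r+1)} Z) = Q x_i^{(r+2)} Z + Q x_i^{(r+1)} Z'` the first summand is the monomial
  -- sought. Each term of the second has a factor of order one, so `hone` applies to it.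
  have hrest : (mon k Q * X (i, r + 1)) * diffD k n (mon k Z) ∈ freeNovikov₀ k n := by
    refine mul_diffD_mon_mem fun a ha => ?_
    have hZe := Multiset.cons_erase ha
    rw [hZ0 a ha, ← mul_assoc, zero_add]
    have := hone (Q + ((i, r + 1) ::ₘ Z.erase a)) a.1 ?_ ?_
    · simpa only [mon_add, mon_cons, mul_assoc] using this
    · have hwa : wt n a = -1 := by simp [wt, hZ0 a ha]
      rw [← hZe, Multiset.map_cons, Multiset.sum_cons, hwa, Multiset.card_cons,
        Multiset.card_erase_of_mem ha] at hZw
      rw [Multiset.map_add, Multiset.sum_add, Multiset.map_cons, Multiset.sum_cons, hQ]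
      rw [hZc] at hZw
      simp only [wt] at hZw ⊢
      push_cast at hZw ⊢
      simp at hZw
      linarith
    · rw [Multiset.card_add, Multiset.card_cons, Multiset.card_erase_of_mem ha, ← hc]
      rw [hZc]
      simp
      omega
  have := sub_mem hprod hrest
  convert this using 1
  rw [novMul, mon_cons, mon_cons, mon_add, Derivation.leibniz, diffD_X]
  simp only [smul_eq_mul]
  ring

/-- The free Novikov algebra consists of the differential polynomials of weight `-1`. -/
theorem mem_freeNovikov₀_iff {f : DiffPoly k n} :
    f ∈ freeNovikov₀ k n ↔ IsWeightedHomogeneous (wt n) f (-1) := by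
  refine ⟨fun h => freeNovikov₀_le h, fun h => ?_⟩
  refine (Submodule.span_le.2 ?_) (mem_span_mon h)
  rintro _ ⟨M, hM, rfl⟩
  exact mon_mem_freeNovikov₀ M hM

theorem isWeightedHomogeneous_aeval_monomial {σ τ : Type*} {w : τ → ℤ} {w' : σ → ℤ}
    {F : σ → MvPolynomial τ k} (hF : ∀ v, IsWeightedHomogeneous w (F v) (w' v))
    (d : σ →₀ ℕ) (c : k) :
    IsWeightedHomogeneous w (aeval F (monomial d c)) (Finsupp.weight w' d) := by
  rw [aeval_monomial, Finsupp.weight_apply, ← zero_add (d.sum _)]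
  refine IsWeightedHomogeneous.mul (isWeightedHomogeneous_C _ _) ?_
  exact IsWeightedHomogeneous.prod _ _ _ fun v _ => (hF v).pow _

/-- A substitution matching the weights respects the gradings. Hence every homogeneous component of
a relation is a relation. -/
theorem weightedHomogeneousComponent_aeval {σ τ : Type*} {w : τ → ℤ} {w' : σ → ℤ}
    {F : σ → MvPolynomial τ k} (hF : ∀ v, IsWeightedHomogeneous w (F v) (w' v)) (m : ℤ)
    (h : MvPolynomial σ k) :
    weightedHomogeneousComponent w m (aeval F h) =
      aeval F (weightedHomogeneousComponent w' m h) := by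
  induction h using MvPolynomial.induction_on' with
  | monomial d c =>
    have h1 := isWeightedHomogeneous_aeval_monomial hF d c
    have h2 := isWeightedHomogeneous_monomial w' d c (m := Finsupp.weight w' d) rfl
    by_cases hm : Finsupp.weight w' d = m
    · subst hm
      rw [h1.weightedHomogeneousComponent_same, h2.weightedHomogeneousComponent_same]
    · rw [h1.weightedHomogeneousComponent_ne _ (Ne.symm hm), h2.weightedHomogeneousComponent_ne _ (Ne.symm hm),
        map_zero]
  | add p q hp hq => simp only [map_add, hp, hq]

theorem isWeightedHomogeneous_aeval {σ τ : Type*} {w : τ → ℤ} {w' : σ → ℤ}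
    {F : σ → MvPolynomial τ k} (hF : ∀ v, IsWeightedHomogeneous w (F v) (w' v)) {m : ℤ}
    {h : MvPolynomial σ k} (hh : IsWeightedHomogeneous w' h m) :
    IsWeightedHomogeneous w (aeval F h) m := by
  rw [← hh.weightedHomogeneousComponent_same, ← weightedHomogeneousComponent_aeval hF]
  exact weightedHomogeneousComponent_isWeightedHomogeneous m _

/-- An element of `N` may mix weights 0 and -1, but its first derivative loses the constant and is
homogeneous of weight 0. -/
theorem isWeightedHomogeneous_iterate_diffD {f : DiffPoly k n} (hf : f ∈ freeNovikov k n) (r : ℕ) :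
    IsWeightedHomogeneous (wt n) ((diffD k n)^[r] (diffD k n f)) (r : ℤ) := by
  induction r with
  | zero =>
    obtain ⟨a, ha, g, hg, rfl⟩ := Submodule.mem_sup.1 hf
    obtain ⟨c, rfl⟩ := Submodule.mem_span_singleton.1 ha
    have := isWeightedHomogeneous_diffD (mem_freeNovikov₀_iff.1 hg)
    simpa using this
  | succ r ih =>
    rw [Function.iterate_succ_apply']
    exact_mod_cast isWeightedHomogeneous_diffD ih

/-- Novikov dependence is differential algebraic dependence. -/
theorem novikovDependent_iff [CharZero k] {p : ℕ} (f : Fin p → DiffPoly k n)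
    (hf : ∀ j, f j ∈ freeNovikov k n) :
    NovikovDependent f ↔ ¬ DiffDim.DIndep (diffD k n) (List.ofFn f) := by
  constructor
  · rintro ⟨h, -, h0, hfh⟩ hind
    rw [DiffDim.dIndep_ofFn] at hind
    exact h0 (hind.eq_zero_of_aeval_eq_zero h hfh)
  · intro hdep
    have hdep' : ¬ DiffDim.DIndep (diffD k n) (List.ofFn fun j => diffD k n (f j)) := by
      intro h
      refine hdep (DiffDim.DIndep.of_map ?_)
      rwa [List.map_ofFn]
    rw [DiffDim.dIndep_ofFn] at hdep'
    -- Some indeterminate `z_j` is needed below to correct the weight; the empty system is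
    -- independent.
    have hp : Nonempty (Fin p) := by
      by_contra hp
      rw [not_nonempty_iff] at hp
      exact hdep' algebraicIndependent_empty_type
    obtain ⟨j⟩ := hp
    rw [algebraicIndependent_iff] at hdep'
    push Not at hdep'
    obtain ⟨h, hh, h0⟩ := hdep'
    obtain ⟨d, hd⟩ := MvPolynomial.ne_zero_iff.1 h0
    set w' : Fin p × ℕ → ℤ := fun v => (v.2 : ℤ) with hw'
    obtain ⟨e, he⟩ : ∃ e : ℕ, Finsupp.weight w' d = e := by
      refine ⟨d.sum fun v c => c * v.2, ?_⟩
      rw [Finsupp.weight_apply, Finsupp.sum, Finsupp.sum]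
      push_cast
      simp [hw']
    have hF : ∀ v : Fin p × ℕ, IsWeightedHomogeneous (wt n)
        ((diffD k n)^[v.2] (diffD k n (f v.1))) (w' v) :=
      fun v => isWeightedHomogeneous_iterate_diffD (hf v.1) v.2
    have hq0 := weightedHomogeneousComponent_aeval hF e h
    rw [hh, map_zero] at hq0
    set q := weightedHomogeneousComponent w' (e : ℤ) h with hq
    have hqne : q ≠ 0 := by
      intro h'
      apply hd
      have := congrArg (coeff d) h'
      classical
      rwa [hq, coeff_weightedHomogeneousComponent, if_pos he, coeff_zero] at this
    set shift : Fin p × ℕ → Fin p × ℕ := fun v => (v.1, v.2 + 1) with hshift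
    have hinj : Function.Injective shift := by
      rintro ⟨a, b⟩ ⟨c, d⟩ h
      simpa [hshift] using h
    -- The shift turns the relation `q` among the `f_j'` into one among the `f_j`, of weight `e`
    -- because `z^{(r+1)}` has weight `r`. The factor `z_j^{e+1}` has weight `-(e+1)`, which brings
    -- the total to `-1`.
    refine ⟨X (j, 0) ^ (e + 1) * rename shift q, ?_, ?_, ?_⟩
    · refine Submodule.mem_sup_right (mem_freeNovikov₀_iff.2 ?_)
      have h1 : IsWeightedHomogeneous (wt p) (rename shift q) (e : ℤ) := by
        rw [rename_eq_aeval]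
        refine isWeightedHomogeneous_aeval (w' := w') (fun v => ?_)
          (weightedHomogeneousComponent_isWeightedHomogeneous _ _)
        have := isWeightedHomogeneous_X k (wt p) (shift v)
        simpa [wt, hshift, hw'] using this
      have h2 := ((isWeightedHomogeneous_X k (wt p) (j, 0)).pow (e + 1)).mul h1
      convert h2 using 1
      simp [wt]
    · exact mul_ne_zero (pow_ne_zero _ (X_ne_zero _))
        ((map_ne_zero_iff _ (rename_injective _ hinj)).2 hqne)
    · rw [diffSubst, map_mul, aeval_rename]
      exact mul_eq_zero_of_right _ hq0.symm

end Novikov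
end

noncomputable section

set_option linter.unusedSectionVars false

/-! ### Transfer along embeddings, and finite witnesses of algebraicity -/

namespace DiffDim

variable {k A B : Type*} [Field k] [CommRing A] [IsDomain A] [Algebra k A] {D : Derivation k A A}
  [CommRing B] [IsDomain B] [Algebra k B] {D' : Derivation k B B}

theorem dIndep_map_iff (φ : A →ₐ[k] B) (hφ : Function.Injective φ)
    (hD : ∀ a, D' (φ a) = φ (D a)) (l : List A) : DIndep D' (l.map φ) ↔ DIndep D l := by
  have hl : l.map φ = List.ofFn fun i : Fin l.length => φ (l.get i) := by
    simp [List.ofFn_getElem_eq_map]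
  have hl' : DIndep D l ↔ DIndep D (List.ofFn l.get) := by rw [List.ofFn_get]
  have hit : ∀ (r : ℕ) (a : A), D'^[r] (φ a) = φ (D^[r] a) := fun r a =>
    ((Function.Semiconj.iterate_right (f := φ) (fun a => (hD a).symm) r) a).symm
  rw [hl, hl', dIndep_ofFn, dIndep_ofFn]
  simp only [hit]
  exact φ.algebraicIndependent_iff hφ

theorem DIndep.of_append {I G : List A} (h : DIndep D (I ++ G)) : DIndep D G := by
  induction I with
  | nil => exact h
  | cons y I ih => exact ih (DIndep.of_cons h)

/-- The polynomial with the given list of coefficients. -/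
def listPoly (cs : List A) : Polynomial A :=
  cs.foldr (fun c q => Polynomial.C c + Polynomial.X * q) 0

theorem eval_listPoly (cs : List A) (y : A) :
    (listPoly cs).eval y = cs.foldr (fun c q => c + y * q) 0 := by
  induction cs with
  | nil => simp [listPoly]
  | cons c cs ih =>
    rw [List.foldr_cons, ← ih]
    simp [listPoly]

theorem coeff_listPoly (cs : List A) (i : ℕ) : (listPoly cs).coeff i = cs.getD i 0 := by
  induction cs generalizing i with
  | nil => simp [listPoly]
  | cons c cs ih =>
    have h : listPoly (c :: cs) = Polynomial.C c + Polynomial.X * listPoly cs := rfl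
    rcases i with _ | i
    · simp [h]
    · simpa [h, Polynomial.coeff_C, Polynomial.coeff_X_mul] using ih i

theorem listPoly_coeffs (p : Polynomial A) :
    listPoly ((List.range (p.natDegree + 1)).map p.coeff) = p := by
  ext i
  rw [coeff_listPoly, List.getD_eq_getElem?_getD, List.getElem?_map]
  by_cases hi : i < p.natDegree + 1
  · simp [List.getElem?_range hi]
  · rw [List.getElem?_eq_none (by simpa using hi)]
    simp [Polynomial.coeff_eq_zero_of_natDegree_lt (by omega : p.natDegree < i)]

/-- Only the first index of a variable selects an entry of `L`, with 0 past the end. The redundant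
second index lets the coefficients be written in the same polynomial ring as the elements
themselves. -/
theorem mem_adjoin_list (L : List A) (x : A) :
    x ∈ Algebra.adjoin k {a | a ∈ L} ↔
      ∃ c : MvPolynomial (ℕ × ℕ) k, aeval (fun v : ℕ × ℕ => L.getD v.1 0) c = x := by
  constructor
  · intro hx
    have : Algebra.adjoin k {a | a ∈ L} ≤
        (aeval (R := k) fun v : ℕ × ℕ => L.getD v.1 0).range := by
      refine Algebra.adjoin_le fun a ha => ?_
      obtain ⟨i, hi, rfl⟩ := List.getElem_of_mem ha
      exact ⟨X (i, 0), by simp [hi]⟩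
    exact this hx
  · rintro ⟨c, rfl⟩
    induction c using MvPolynomial.induction_on with
    | C a => simp
    | add p q hp hq => rw [map_add]; exact add_mem hp hq
    | mul_X p v hp =>
      rw [map_mul, aeval_X]
      refine mul_mem hp ?_
      by_cases hv : v.1 < L.length
      · rw [List.getD_eq_getElem _ _ hv]
        exact Algebra.subset_adjoin (List.getElem_mem hv)
      · rw [List.getD_eq_default _ _ (not_lt.1 hv)]
        exact zero_mem _

/-- Algebraicity over a finite list is witnessed by a list of coefficients. -/
theorem mem_cl_list (L : List A) (y : A) :
    y ∈ cl k {a | a ∈ L} ↔ ∃ cs : List (MvPolynomial (ℕ × ℕ) k),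
      (cs.map (aeval fun v : ℕ × ℕ => L.getD v.1 0)).foldr (fun c q => c + y * q) 0 = 0 ∧
      ∃ c ∈ cs, aeval (fun v : ℕ × ℕ => L.getD v.1 0) c ≠ 0 := by
  rw [mem_cl, isAlgebraic_iff_exists_polynomial]
  constructor
  · rintro ⟨p, hp, hc, hy⟩
    choose c hc using fun i => (mem_adjoin_list L _).1 (hc i)
    -- The leading coefficient is the one that does not vanish.
    refine ⟨(List.range (p.natDegree + 1)).map c, ?_, c p.natDegree,
      List.mem_map.2 ⟨_, by simp, rfl⟩, ?_⟩
    · rw [List.map_map, ← eval_listPoly]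
      have : ⇑(aeval fun v : ℕ × ℕ => L.getD v.1 0) ∘ c = p.coeff := funext hc
      rw [this, listPoly_coeffs, hy]
    · rw [hc]
      simpa using hp
  · rintro ⟨cs, h0, c, hc, hne⟩
    refine ⟨listPoly (cs.map (aeval fun v : ℕ × ℕ => L.getD v.1 0)), ?_, fun i => ?_, ?_⟩
    · intro h
      obtain ⟨i, hi, rfl⟩ := List.getElem_of_mem hc
      have := coeff_listPoly (cs.map (aeval fun v : ℕ × ℕ => L.getD v.1 0)) i
      rw [h] at this
      simp [hi] at this
      exact hne (by simpa using this.symm)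
    · rw [coeff_listPoly]
      by_cases hi : i < cs.length
      · rw [List.getD_eq_getElem _ _ (by simpa using hi), List.getElem_map]
        exact (mem_adjoin_list L _).2 ⟨_, rfl⟩
      · rw [List.getD_eq_default _ _ (by simpa using hi)]
        exact zero_mem _
    · rw [eval_listPoly, h0]

end DiffDim

/-! ### Differential polynomials in countably many indeterminates -/

namespace Novikov

open DiffDim

variable (k : Type*) [Field k]

/-- The derivation of the differential polynomial algebra in countably many indeterminates. -/
def univD : Derivation k (MvPolynomial (ℕ × ℕ) k) (MvPolynomial (ℕ × ℕ) k) :=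
  mkDerivation k fun v => X (v.1, v.2 + 1)

/-- The embedding into the differential polynomial algebra in countably many indeterminates. -/
def emb (n : ℕ) : DiffPoly k n →ₐ[k] MvPolynomial (ℕ × ℕ) k :=
  rename fun v : Fin n × ℕ => ((v.1 : ℕ), v.2)

variable {k}

theorem univD_X (v : ℕ × ℕ) : univD k (X v) = X (v.1, v.2 + 1) := mkDerivation_X _ _ _

theorem iterate_univD_X (i s r : ℕ) :
    (univD k)^[r] (X (i, s)) = X (i, s + r) := by
  induction r with
  | zero => rfl
  | succ r ih => rw [Function.iterate_succ_apply', ih, univD_X]; rfl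

theorem emb_injective (n : ℕ) : Function.Injective (emb k n) := by
  refine rename_injective _ ?_
  rintro ⟨a, b⟩ ⟨c, d⟩ h
  simpa [Fin.ext_iff] using h

theorem univD_emb {n : ℕ} (f : DiffPoly k n) : univD k (emb k n f) = emb k n (diffD k n f) := by
  induction f using MvPolynomial.induction_on with
  | C a => simp [emb, ← MvPolynomial.algebraMap_eq]
  | add p q hp hq => simp only [map_add, hp, hq]
  | mul_X p v hp =>
    have hX : ∀ v : Fin n × ℕ, emb k n (X v) = X ((v.1 : ℕ), v.2) := fun v => rename_X _ _
    rw [map_mul, Derivation.leibniz, Derivation.leibniz, hp, hX, univD_X, diffD_X]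
    simp only [smul_eq_mul, map_add, map_mul, hX]

theorem dIndep_univ_generators (N : ℕ) :
    DIndep (univD k) ((List.range N).map fun j => X (j, 0)) := by
  have h : ((List.range N).map fun j => (X (j, 0) : MvPolynomial (ℕ × ℕ) k)) =
      List.ofFn fun i : Fin N => X ((i : ℕ), 0) := by
    refine List.ext_getElem (by simp) fun i _ _ => by simp
  rw [h, dIndep_ofFn]
  simp only [iterate_univD_X, zero_add]
  refine (algebraicIndependent_X (ℕ × ℕ) k).comp (fun v : Fin N × ℕ => ((v.1 : ℕ), v.2)) ?_
  rintro ⟨a, b⟩ ⟨c, d⟩ h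
  simpa [Fin.ext_iff] using h

theorem derivs_generators_mono {N N' m m' : ℕ} (hN : N ≤ N') (hm : m ≤ m') :
    derivs (univD k) ((List.range N).map fun j => X (j, 0)) m ⊆
      derivs (univD k) ((List.range N').map fun j => X (j, 0)) m' := by
  rintro _ ⟨g, hg, s, hs, rfl⟩
  obtain ⟨i, hi, rfl⟩ := List.mem_map.1 hg
  exact ⟨_, List.mem_map.2 ⟨i, List.mem_range.2 ((List.mem_range.1 hi).trans_le hN), rfl⟩, s,
    hs.trans_le hm, rfl⟩

theorem exists_mem_adjoin (f : MvPolynomial (ℕ × ℕ) k) :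
    ∃ N m, f ∈ Algebra.adjoin k
      (derivs (univD k) ((List.range N).map fun j => X (j, 0)) m) := by
  induction f using MvPolynomial.induction_on with
  | C a => exact ⟨0, 0, Subalgebra.algebraMap_mem _ a⟩
  | add p q hp hq =>
    obtain ⟨N, m, h⟩ := hp
    obtain ⟨N', m', h'⟩ := hq
    exact ⟨N + N', m + m', add_mem
      (Algebra.adjoin_mono (derivs_generators_mono (by omega) (by omega)) h)
      (Algebra.adjoin_mono (derivs_generators_mono (by omega) (by omega)) h')⟩
  | mul_X p v hp =>
    obtain ⟨N, m, h⟩ := hp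
    refine ⟨N + (v.1 + 1), m + (v.2 + 1), mul_mem
      (Algebra.adjoin_mono (derivs_generators_mono (by omega) (by omega)) h)
      (Algebra.subset_adjoin ⟨X (v.1, 0), List.mem_map.2 ⟨v.1, by simp; omega, rfl⟩, v.2,
        by omega, ?_⟩)⟩
    rw [iterate_univD_X, zero_add]

theorem exists_mem_cl_generators (G : List (MvPolynomial (ℕ × ℕ) k)) :
    ∃ N m, ∀ g ∈ G, g ∈ cl k (derivs (univD k) ((List.range N).map fun j => X (j, 0)) m) := by
  induction G with
  | nil => exact ⟨0, 0, by simp⟩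
  | cons g G ih =>
    obtain ⟨N, m, h⟩ := ih
    obtain ⟨N', m', h'⟩ := exists_mem_adjoin g
    refine ⟨N + N', m + m', fun f hf => ?_⟩
    rcases List.mem_cons.1 hf with rfl | hf
    · exact cl_mono (derivs_generators_mono (by omega) (by omega)) (adjoin_subset_cl _ h')
    · exact cl_mono (derivs_generators_mono (by omega) (by omega)) (h f hf)

/-- Differential independence is witnessed by a completion to a differential transcendence basis. -/
theorem dIndep_univ_iff [CharZero k] (G : List (MvPolynomial (ℕ × ℕ) k)) :
    DIndep (univD k) G ↔ ∃ (N : ℕ) (I : List ℕ), I.length + G.length ≤ N ∧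
      ∀ j < N, DAlg (univD k) (X (j, 0)) ((I.map fun i => X (i, 0)) ++ G) := by
  constructor
  · intro h
    obtain ⟨N, m, hm⟩ := exists_mem_cl_generators G
    obtain ⟨I, hI⟩ := h.exists_completion (x := fun j => X (j, 0)) hm
    exact ⟨N, I, hI⟩
  · rintro ⟨N, I, hlen, hI⟩
    refine DIndep.of_append (I := I.map fun i => X (i, 0)) ?_
    -- The `N` independent indeterminates are differentially algebraic over a list of length at most
    -- `N`, which must then be independent, and with it its tail `G`.
    refine (dIndep_univ_generators N).of_forall_dAlg (by simpa using hlen) ?_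
    intro x hx
    obtain ⟨j, hj, rfl⟩ := List.mem_map.1 hx
    exact hI j (List.mem_range.1 hj)

end Novikov
end

/-! ### Written polynomials, their arithmetic and certificates -/

noncomputable section

namespace Novikov

open DiffDim

/-- A written differential polynomial in countably many indeterminates; the coefficient of a term is
a formal product of numbered elements of the field. -/
abbrev Code : Type := List (List ℕ × List (ℕ × ℕ))

namespace Code

variable {k : Type*} [Field k] (ν : ℕ → k)

/-- The differential polynomial that a code denotes. -/
def val (c : Code) : MvPolynomial (ℕ × ℕ) k :=
  (c.map fun t => C (t.1.map ν).prod * mon k (t.2 : Multiset (ℕ × ℕ))).sum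

/-- The product of two codes. -/
def mul (c d : Code) : Code :=
  c.flatMap fun t => d.map fun u => (t.1 ++ u.1, t.2 ++ u.2)

/-- The terms of the derivative of a monomial. -/
def derivMon (l : List (ℕ × ℕ)) : List (List (ℕ × ℕ)) :=
  l.rec [] fun v l ih => ((v.1, v.2 + 1) :: l) :: ih.map (v :: ·)

/-- The derivative of a code. -/
def deriv (c : Code) : Code :=
  c.flatMap fun t => (derivMon t.2).map fun l => (t.1, l)

/-- The substitution of the members of a list for the indeterminates. -/
def subst (S : List Code) (c : Code) : Code :=
  c.flatMap fun t => t.2.foldr (fun v acc => mul (S.getD v.1 []) acc) [(t.1, [])]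

/-- The value at `y` of the polynomial with given coefficients. -/
def horner (cs : List Code) (y : Code) : Code :=
  cs.foldr (fun c acc => c ++ mul y acc) []

/-- The derivatives of order less than `M` of the members of a list. -/
def derivList (G : List Code) (M : ℕ) : List Code :=
  G.flatMap fun g => (List.range M).map fun s => deriv^[s] g

/-- The code of an indeterminate. -/
def var (j : ℕ) : Code := [([], [(j, 0)])]

/-- The code of a list of terms with numbered coefficients. -/
def ofRaw (c : List (ℕ × List (ℕ × ℕ))) : Code := c.map fun t => ([t.1], t.2)

@[simp] theorem val_nil : val ν [] = 0 := rfl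

@[simp] theorem val_cons (t : List ℕ × List (ℕ × ℕ)) (c : Code) :
    val ν (t :: c) = C (t.1.map ν).prod * mon k (t.2 : Multiset (ℕ × ℕ)) + val ν c := rfl

@[simp] theorem val_append (c d : Code) : val ν (c ++ d) = val ν c + val ν d := by
  simp [val]

theorem mon_coe_append (l m : List (ℕ × ℕ)) :
    mon k ((l ++ m : List (ℕ × ℕ)) : Multiset (ℕ × ℕ)) = mon k (l : Multiset (ℕ × ℕ)) * mon k m := by
  rw [← Multiset.coe_add, mon_add]

theorem mon_coe_cons (v : ℕ × ℕ) (l : List (ℕ × ℕ)) :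
    mon k ((v :: l : List (ℕ × ℕ)) : Multiset (ℕ × ℕ)) = X v * mon k (l : Multiset (ℕ × ℕ)) := by
  rw [← Multiset.cons_coe, mon_cons]

@[simp] theorem val_mul (c d : Code) : val ν (mul c d) = val ν c * val ν d := by
  have h : ∀ (t : List ℕ × List (ℕ × ℕ)) (d : Code),
      val ν (d.map fun u => (t.1 ++ u.1, t.2 ++ u.2)) =
        C (t.1.map ν).prod * mon k (t.2 : Multiset (ℕ × ℕ)) * val ν d := by
    intro t d
    induction d with
    | nil => simp
    | cons u d ih =>
      rw [List.map_cons, val_cons, val_cons, ih, List.map_append, List.prod_append, map_mul,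
        mon_coe_append]
      ring
  induction c with
  | nil => simp [mul]
  | cons t c ih =>
    have : mul (t :: c) d = (d.map fun u => (t.1 ++ u.1, t.2 ++ u.2)) ++ mul c d := rfl
    rw [this, val_append, h, ih, val_cons, add_mul]

@[simp] theorem val_deriv (c : Code) : val ν (deriv c) = univD k (val ν c) := by
  have h : ∀ (a : List ℕ) (l : List (ℕ × ℕ)), val ν ((derivMon l).map fun l => (a, l)) =
      C (a.map ν).prod * univD k (mon k (l : Multiset (ℕ × ℕ))) := by
    intro a l
    induction l with
    | nil => simp [derivMon]
    | cons v l ih =>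
      have h1 : derivMon (v :: l) = ((v.1, v.2 + 1) :: l) :: (derivMon l).map (v :: ·) := rfl
      have h2 : ∀ L : List (List (ℕ × ℕ)), val ν ((L.map (v :: ·)).map fun l => (a, l)) =
          X v * val ν (L.map fun l => (a, l)) := by
        intro L
        induction L with
        | nil => simp
        | cons m L ih =>
          rw [List.map_cons, List.map_cons, List.map_cons, val_cons, val_cons, ih, mon_coe_cons]
          ring
      rw [h1, List.map_cons, val_cons, h2, ih, mon_coe_cons, mon_coe_cons, Derivation.leibniz,
        univD_X]
      simp only [smul_eq_mul]
      ring
  induction c with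
  | nil => simp [deriv]
  | cons t c ih =>
    have : deriv (t :: c) = ((derivMon t.2).map fun l => (t.1, l)) ++ deriv c := rfl
    rw [this, val_append, h, ih, val_cons, map_add, Derivation.leibniz]
    simp [← MvPolynomial.algebraMap_eq]

theorem val_iterate_deriv (c : Code) (r : ℕ) : val ν (deriv^[r] c) = (univD k)^[r] (val ν c) := by
  induction r with
  | zero => rfl
  | succ r ih => rw [Function.iterate_succ_apply', Function.iterate_succ_apply', val_deriv, ih]

theorem val_getD (S : List Code) (i : ℕ) : val ν (S.getD i []) = (S.map (val ν)).getD i 0 := by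
  rw [← val_nil ν, List.getD_map]

@[simp] theorem val_subst (S : List Code) (c : Code) :
    val ν (subst S c) = aeval (fun v : ℕ × ℕ => (S.map (val ν)).getD v.1 0) (val ν c) := by
  have h : ∀ (a : List ℕ) (l : List (ℕ × ℕ)),
      val ν (l.foldr (fun v acc => mul (S.getD v.1 []) acc) [(a, [])]) =
        aeval (fun v : ℕ × ℕ => (S.map (val ν)).getD v.1 0)
          (C (a.map ν).prod * mon k (l : Multiset (ℕ × ℕ))) := by
    intro a l
    induction l with
    | nil => simp [MvPolynomial.algebraMap_eq]
    | cons v l ih =>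
      rw [List.foldr_cons, val_mul, ih, mon_coe_cons, val_getD]
      simp only [map_mul, aeval_X]
      ring
  induction c with
  | nil => simp [subst]
  | cons t c ih =>
    have : subst S (t :: c) =
      t.2.foldr (fun v acc => mul (S.getD v.1 []) acc) [(t.1, [])] ++ subst S c := rfl
    rw [this, val_append, h, ih, val_cons, map_add]

theorem val_horner (cs : List Code) (y : Code) :
    val ν (horner cs y) = (cs.map (val ν)).foldr (fun c q => c + val ν y * q) 0 := by
  induction cs with
  | nil => rfl
  | cons c cs ih =>
    have : horner (c :: cs) y = c ++ mul y (horner cs y) := rfl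
    rw [this, val_append, val_mul, ih]; rfl

theorem mem_map_val_derivList (G : List Code) (M : ℕ) :
    {a | a ∈ (derivList G M).map (val ν)} = derivs (univD k) (G.map (val ν)) M := by
  ext a
  simp only [derivList, List.mem_map, List.mem_flatMap, List.mem_range, Set.mem_ofPred_eq, derivs]
  constructor
  · rintro ⟨_, ⟨g, hg, s, hs, rfl⟩, rfl⟩
    exact ⟨_, ⟨g, hg, rfl⟩, s, hs, (val_iterate_deriv ν g s).symm⟩
  · rintro ⟨_, ⟨g, hg, rfl⟩, s, hs, rfl⟩
    exact ⟨_, ⟨g, hg, s, hs, rfl⟩, val_iterate_deriv ν g s⟩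

theorem val_var (j : ℕ) : val ν (var j) = X (j, 0) := by
  simp [var, mon]

theorem val_surjective {ν : ℕ → k} (hν : Function.Surjective ν) : Function.Surjective (val ν) := by
  intro f
  induction f using MvPolynomial.induction_on with
  | C a =>
    obtain ⟨b, rfl⟩ := hν a
    exact ⟨[([b], [])], by simp⟩
  | add p q hp hq =>
    obtain ⟨c, rfl⟩ := hp
    obtain ⟨d, rfl⟩ := hq
    exact ⟨c ++ d, val_append ν c d⟩
  | mul_X p v hp =>
    obtain ⟨c, rfl⟩ := hp
    exact ⟨mul c [([], [v])], by simp [mon]⟩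

theorem val_ofRaw_raw {n : ℕ} (c : DiffCode n) :
    val ν (ofRaw c.raw) = emb k n (DiffCode.value ν c) := by
  induction c with
  | nil => simp [ofRaw, DiffCode.raw, DiffCode.value]
  | cons t c ih =>
    have h1 : ofRaw (DiffCode.raw (t :: c)) =
      ([t.1], t.2.map fun v => ((v.1 : ℕ), v.2)) :: ofRaw (DiffCode.raw c) := rfl
    have h2 : DiffCode.value ν (t :: c) =
      C (ν t.1) * (t.2.map fun v => X v).prod + DiffCode.value ν c := rfl
    rw [h1, val_cons, ih, h2, map_add, map_mul]
    congr 1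
    simp only [List.map_cons, List.map_nil, List.prod_cons, List.prod_nil, mul_one, mon,
      Multiset.map_coe, Multiset.prod_coe, List.map_map, map_list_prod]
    congr 1
    · simp [emb]
    · congr 1
      refine List.map_congr_left fun v _ => ?_
      simp [emb]

theorem coeff_val (c : Code) (d : (ℕ × ℕ) →₀ ℕ) :
    coeff d (val ν c) = (c.map fun t =>
      if Multiset.toFinsupp (t.2 : Multiset (ℕ × ℕ)) = d then (t.1.map ν).prod else 0).sum := by
  induction c with
  | nil => simp
  | cons t c ih =>
    rw [val_cons, coeff_add, ih, List.map_cons, List.sum_cons, coeff_C_mul, mon_eq_monomial,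
      coeff_monomial]
    simp

/-- The sum over the terms whose factors are a permutation of those of `t` is the coefficient of
that monomial, and monomials not written in `c` have coefficient zero. So finitely many sums in the
field decide the question. -/
theorem val_eq_zero_iff (c : Code) :
    val ν c = 0 ↔ ∀ t ∈ c,
      (c.map fun u => if u.2.Perm t.2 then (u.1.map ν).prod else 0).sum = 0 := by
  have key : ∀ t : List ℕ × List (ℕ × ℕ),
      (c.map fun u => if u.2.Perm t.2 then (u.1.map ν).prod else 0).sum =
        coeff (Multiset.toFinsupp (t.2 : Multiset (ℕ × ℕ))) (val ν c) := by
    intro t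
    rw [coeff_val]
    simp only [EmbeddingLike.apply_eq_iff_eq, Multiset.coe_eq_coe]
  simp only [key]
  constructor
  · intro h t _
    rw [h, coeff_zero]
  · intro h
    ext d
    rw [coeff_zero]
    by_cases hd : ∃ t ∈ c, Multiset.toFinsupp (t.2 : Multiset (ℕ × ℕ)) = d
    · obtain ⟨t, ht, rfl⟩ := hd
      exact h t ht
    · push Not at hd
      rw [coeff_val]
      refine List.sum_eq_zero fun x hx => ?_
      obtain ⟨t, ht, rfl⟩ := List.mem_map.1 hx
      rw [if_neg (hd t ht)]

/-- `zero` decides which codes denote zero. -/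
def IsZeroTest (zero : Code → Bool) : Prop := ∀ c, zero c = true ↔ val ν c = 0

/-- The check of a certificate for algebraicity of `y` over `S`. -/
def algCheck (zero : Code → Bool) (y : Code) (S cs : List Code) : Bool :=
  zero (horner (cs.map (subst S)) y) && cs.any fun c => !zero (subst S c)

/-- The check of a certificate for differential algebraicity of `y` over `G`. -/
def dAlgCheck (zero : Code → Bool) (y : Code) (G : List Code) (w : ℕ × ℕ × List Code) : Bool :=
  algCheck zero (deriv^[w.1] y) (derivList [y] w.1 ++ derivList G w.2.1) w.2.2

/-- The check of a certificate for differential dependence of `l`. -/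
def depCheck (zero : Code → Bool) (l : List Code) (w : ℕ × ℕ × ℕ × List Code) : Bool :=
  decide (w.1 < l.length) && dAlgCheck zero (l.getD w.1 []) (l.drop (w.1 + 1)) w.2

/-- The check of a certificate for differential independence of `l`. -/
def indepCheck (zero : Code → Bool) (l : List Code)
    (w : ℕ × List ℕ × List (ℕ × ℕ × List Code)) : Bool :=
  decide (w.2.1.length + l.length ≤ w.1) &&
    (List.range w.1).all fun j =>
      dAlgCheck zero (var j) (w.2.1.map var ++ l) (w.2.2.getD j (0, 0, []))

variable {ν} {zero : Code → Bool}

/-- `mem_cl_list` supplies a list of coefficients, and since `ν` is surjective each of them has a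
code. -/
theorem exists_algCheck_iff (hν : Function.Surjective ν) (hz : IsZeroTest ν zero) (y : Code)
    (S : List Code) :
    (∃ cs, algCheck zero y S cs = true) ↔ val ν y ∈ cl k {a | a ∈ S.map (val ν)} := by
  rw [mem_cl_list]
  have h : ∀ cs, algCheck zero y S cs = true ↔
      ((cs.map (val ν)).map (aeval fun v : ℕ × ℕ => (S.map (val ν)).getD v.1 0)).foldr
        (fun c q => c + val ν y * q) 0 = 0 ∧
      ∃ c ∈ cs.map (val ν), aeval (fun v : ℕ × ℕ => (S.map (val ν)).getD v.1 0) c ≠ 0 := by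
    intro cs
    have h1 : (cs.map (subst S)).map (val ν) =
        (cs.map (val ν)).map (aeval fun v : ℕ × ℕ => (S.map (val ν)).getD v.1 0) := by
      simp [Function.comp_def]
    rw [algCheck, Bool.and_eq_true, hz, val_horner, h1]
    refine and_congr_right fun _ => ?_
    have hz' : ∀ c, (!zero c) = true ↔ val ν c ≠ 0 := fun c => by
      rw [Ne, ← hz c, Bool.not_eq_true']; simp
    simp only [List.any_eq_true, hz', val_subst, List.mem_map, exists_exists_and_eq_and]
  constructor
  · rintro ⟨cs, hcs⟩
    exact ⟨_, (h cs).1 hcs⟩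
  · rintro ⟨cs, hcs⟩
    obtain ⟨cs, rfl⟩ := (List.map_surjective_iff.2 (val_surjective hν)) cs
    exact ⟨cs, (h cs).2 hcs⟩

theorem exists_dAlgCheck_iff (hν : Function.Surjective ν) (hz : IsZeroTest ν zero) (y : Code)
    (G : List Code) :
    (∃ w, dAlgCheck zero y G w = true) ↔ DAlg (univD k) (val ν y) (G.map (val ν)) := by
  have h : ∀ R M, (∃ cs, dAlgCheck zero y G (R, M, cs) = true) ↔
      (univD k)^[R] (val ν y) ∈ cl k (derivs (univD k) [val ν y] R ∪
        derivs (univD k) (G.map (val ν)) M) := by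
    intro R M
    have := exists_algCheck_iff hν hz (deriv^[R] y) (derivList [y] R ++ derivList G M)
    rw [val_iterate_deriv] at this
    have hset : {a | a ∈ (derivList [y] R ++ derivList G M).map (val ν)} =
        derivs (univD k) [val ν y] R ∪ derivs (univD k) (G.map (val ν)) M := by
      rw [← mem_map_val_derivList]
      have := mem_map_val_derivList ν [y] R
      rw [List.map_singleton] at this
      rw [← this]
      ext a
      simp only [List.map_append, List.mem_append, Set.mem_ofPred_eq, Set.mem_union]
    rw [hset] at this
    exact this
  constructor
  · rintro ⟨⟨R, M, cs⟩, hw⟩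
    exact ⟨R, M, (h R M).1 ⟨cs, hw⟩⟩
  · rintro ⟨R, M, hRM⟩
    obtain ⟨cs, hcs⟩ := (h R M).2 hRM
    exact ⟨_, hcs⟩

theorem exists_depCheck_iff [CharZero k] (hν : Function.Surjective ν) (hz : IsZeroTest ν zero)
    (l : List Code) :
    (∃ w, depCheck zero l w = true) ↔ ¬ DIndep (univD k) (l.map (val ν)) := by
  rw [not_dIndep_iff]
  have h : ∀ i (hi : i < l.length), (∃ w, dAlgCheck zero (l.getD i []) (l.drop (i + 1)) w = true) ↔
      DAlg (univD k) ((l.map (val ν))[i]'(by simpa using hi)) ((l.map (val ν)).drop (i + 1)) := by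
    intro i hi
    rw [exists_dAlgCheck_iff hν hz, List.getD_eq_getElem _ _ hi, List.getElem_map, List.map_drop]
  constructor
  · rintro ⟨⟨i, w⟩, hw⟩
    rw [depCheck, Bool.and_eq_true, decide_eq_true_iff] at hw
    exact ⟨i, by simpa using hw.1, (h i hw.1).1 ⟨w, hw.2⟩⟩
  · rintro ⟨i, hi, hd⟩
    rw [List.length_map] at hi
    obtain ⟨w, hw⟩ := (h i hi).2 hd
    exact ⟨(i, w), by rw [depCheck, Bool.and_eq_true, decide_eq_true_iff]; exact ⟨hi, hw⟩⟩

theorem exists_indepCheck_iff [CharZero k] (hν : Function.Surjective ν) (hz : IsZeroTest ν zero)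
    (l : List Code) :
    (∃ w, indepCheck zero l w = true) ↔ DIndep (univD k) (l.map (val ν)) := by
  rw [dIndep_univ_iff]
  have h : ∀ (I : List ℕ) j, (∃ w, dAlgCheck zero (var j) (I.map var ++ l) w = true) ↔
      DAlg (univD k) (X (j, 0)) ((I.map fun i => X (i, 0)) ++ l.map (val ν)) := by
    intro I j
    rw [exists_dAlgCheck_iff hν hz, val_var, List.map_append, List.map_map]
    simp [Function.comp_def, val_var]
  have hc : ∀ w, indepCheck zero l w = true ↔ w.2.1.length + l.length ≤ w.1 ∧ ∀ j < w.1,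
      dAlgCheck zero (var j) (w.2.1.map var ++ l) (w.2.2.getD j (0, 0, [])) = true := by
    intro w
    rw [indepCheck, Bool.and_eq_true, decide_eq_true_iff, List.all_eq_true]
    simp only [List.mem_range]
  rw [List.length_map]
  constructor
  · rintro ⟨⟨N, I, ws⟩, hw⟩
    obtain ⟨hlen, hw⟩ := (hc _).1 hw
    exact ⟨N, I, hlen, fun j hj => (h I j).1 ⟨_, hw j hj⟩⟩
  · rintro ⟨N, I, hlen, hd⟩
    -- Indices from `N` on get a dummy witness, so that a choice function on all of `ℕ` can be
    -- tabulated into one finite certificate.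
    have hex : ∀ j, ∃ w, j < N → dAlgCheck zero (var j) (I.map var ++ l) w = true := by
      intro j
      by_cases hj : j < N
      · obtain ⟨w, hw⟩ := (h I j).2 (hd j hj)
        exact ⟨w, fun _ => hw⟩
      · exact ⟨(0, 0, []), fun h => absurd h hj⟩
    choose w hw using hex
    refine ⟨(N, I, (List.range N).map w), (hc _).2 ⟨hlen, fun j hj => ?_⟩⟩
    rw [List.getD_eq_getElem _ _ (by simpa using hj)]
    simpa using hw j hj

end Code

end Novikov
end

/-! ### Computability of list operations and of unbounded search -/

noncomputable section

namespace Computability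

variable {α β σ : Type*} [Primcodable α] [Primcodable β] [Primcodable σ]

/-- Recursion on the number of entries consumed. The step need only be computable, as for the field
operations, which are not assumed primitive recursive. -/
theorem computable_list_foldl {f : α → List β} {g : α → σ} {h : α → σ × β → σ}
    (hf : Computable f) (hg : Computable g) (hh : Computable₂ h) :
    Computable fun a => (f a).foldl (fun s b => h a (s, b)) (g a) := by
  have hstep : Computable₂ fun (a : α) (p : ℕ × σ) =>
      Option.casesOn (motive := fun _ => σ) ((f a)[p.1]?) p.2 fun b => h a (p.2, b) := by
    refine Computable.option_casesOn (o := fun q : α × ℕ × σ => (f q.1)[q.2.1]?)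
      (f := fun q => q.2.2) (g := fun q b => h q.1 (q.2.2, b)) ?_ ?_ ?_
    · exact Computable.list_getElem?.comp (hf.comp Computable.fst)
        (Computable.fst.comp Computable.snd)
    · exact Computable.snd.comp Computable.snd
    · exact hh.comp (Computable.fst.comp Computable.fst)
        (Computable.pair (Computable.snd.comp (Computable.snd.comp Computable.fst)) Computable.snd)
  refine (Computable.nat_rec (Computable.list_length.comp hf) hg hstep).of_eq fun a => ?_
  have key : ∀ n, Nat.rec (motive := fun _ => σ) (g a) (fun i s =>
      Option.casesOn (motive := fun _ => σ) ((f a)[i]?) s fun b => h a (s, b)) n =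
      ((f a).take n).foldl (fun s b => h a (s, b)) (g a) := by
    intro n
    induction n with
    | zero => simp
    | succ n ih =>
      simp only [ih, List.take_add_one, List.foldl_append]
      cases (f a)[n]? <;> rfl
  rw [key, List.take_length]

theorem computable_list_all {f : α → List β} {q : α → β → Bool} (hf : Computable f)
    (hq : Computable₂ q) : Computable fun a => (f a).all (q a) := by
  have h := computable_list_foldl (h := fun a (p : Bool × β) => p.1 && q a p.2) hf
    (Computable.const true)
    (Primrec.and.to_comp.comp (Computable.fst.comp Computable.snd)
      (hq.comp Computable.fst (Computable.snd.comp Computable.snd)))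
  refine h.of_eq fun a => ?_
  have key : ∀ (l : List β) (b : Bool), l.foldl (fun s b => s && q a b) b = (b && l.all (q a)) := by
    intro l
    induction l with
    | nil => simp
    | cons x l ih => intro b; simp [ih, Bool.and_assoc]
  simpa using key (f a) true

theorem computable_list_any {f : α → List β} {q : α → β → Bool} (hf : Computable f)
    (hq : Computable₂ q) : Computable fun a => (f a).any (q a) := by
  have h := Primrec.not.to_comp.comp (computable_list_all (q := fun a b => !q a b) hf
    (Primrec.not.to_comp.comp hq))
  refine h.of_eq fun a => ?_
  simp [List.all_eq_not_any_not]

theorem rePred_exists {q : α → β → Bool} (hq : Computable₂ q) :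
    REPred fun a => ∃ b, q a b = true := by
  have h1 : Computable₂ fun (a : α) (n : ℕ) =>
      Option.casesOn (motive := fun _ => Bool) (Encodable.decode (α := β) n) false (q a) := by
    refine Computable.option_casesOn (o := fun p : α × ℕ => Encodable.decode (α := β) p.2)
      (f := fun _ => false) (g := fun p b => q p.1 b) ?_ ?_ ?_
    · exact Computable.decode.comp Computable.snd
    · exact Computable.const false
    · exact hq.comp (Computable.fst.comp Computable.fst) Computable.snd
  refine (Partrec.dom_re (Partrec.rfind h1.partrec₂)).of_eq fun a => ?_
  rw [Nat.rfind_dom']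
  constructor
  · rintro ⟨n, hn, -⟩
    cases hd : Encodable.decode (α := β) n with
    | none => simp [hd] at hn
    | some b => exact ⟨b, by simpa [hd] using hn⟩
  · rintro ⟨b, hb⟩
    exact ⟨Encodable.encode b, by simpa using hb, fun _ => trivial⟩

theorem primrec_count [DecidableEq β] : Primrec₂ fun (l : List β) (x : β) => l.count x := by
  have h : Primrec fun p : List β × β => p.1.foldl (fun n y => if y = p.2 then n + 1 else n) 0 := by
    refine Primrec.list_foldl (h := fun p (q : ℕ × β) => if q.2 = p.2 then q.1 + 1 else q.1)
      Primrec.fst (Primrec.const 0) ?_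
    refine Primrec.ite ?_ ?_ ?_
    · exact Primrec.eq.comp (Primrec.snd.comp Primrec.snd) (Primrec.snd.comp Primrec.fst)
    · exact Primrec.succ.comp (Primrec.fst.comp Primrec.snd)
    · exact Primrec.fst.comp Primrec.snd
  refine h.of_eq fun p => ?_
  have key : ∀ (l : List β) (m : ℕ),
      l.foldl (fun n y => if y = p.2 then n + 1 else n) m = m + l.count p.2 := by
    intro l
    induction l with
    | nil => simp
    | cons x l ih =>
      intro m
      rw [List.foldl_cons, ih, List.count_cons]
      by_cases hx : x = p.2 <;> simp [hx]; omega
  simpa using key p.1 0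

/-- Multiplicities need comparing only at entries of the two lists, since all others occur zero
times in both. -/
theorem exists_permTest (β : Type*) [Primcodable β] :
    ∃ q : List β × List β → Bool, Computable q ∧ ∀ p, q p = true ↔ p.1.Perm p.2 := by
  classical
  have h := computable_list_all (f := fun p : List β × List β => p.1 ++ p.2)
    (q := fun p x => decide (p.1.count x = p.2.count x))
    (Computable.list_append.comp Computable.fst Computable.snd)
    ((Primrec.eq.decide.comp
      (primrec_count.comp (Primrec.fst.comp Primrec.fst) Primrec.snd)
      (primrec_count.comp (Primrec.snd.comp Primrec.fst) Primrec.snd)).to_comp)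
  refine ⟨_, h, fun p => ?_⟩
  rw [List.all_eq_true, List.perm_iff_count]
  simp only [decide_eq_true_iff, List.mem_append]
  refine ⟨fun h x => ?_, fun h x _ => h x⟩
  by_cases hx : x ∈ p.1 ∨ x ∈ p.2
  · exact h x hx
  · rw [not_or] at hx
    rw [List.count_eq_zero_of_not_mem hx.1, List.count_eq_zero_of_not_mem hx.2]

end Computability

/-! ### Computability of the checks and the decision procedure -/

namespace Novikov

open Computability

namespace Code

theorem primrec_mul : Primrec₂ mul := by
  refine Primrec.list_flatMap (f := fun p : Code × Code => p.1)
    (g := fun p t => p.2.map fun u => (t.1 ++ u.1, t.2 ++ u.2)) Primrec.fst ?_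
  refine Primrec.list_map (f := fun q : (Code × Code) × (List ℕ × List (ℕ × ℕ)) => q.1.2)
    (g := fun q u => (q.2.1 ++ u.1, q.2.2 ++ u.2)) (Primrec.snd.comp Primrec.fst) ?_
  refine Primrec.pair ?_ ?_
  · exact Primrec.list_append.comp (Primrec.fst.comp (Primrec.snd.comp Primrec.fst))
      (Primrec.fst.comp Primrec.snd)
  · exact Primrec.list_append.comp (Primrec.snd.comp (Primrec.snd.comp Primrec.fst))
      (Primrec.snd.comp Primrec.snd)

theorem primrec_derivMon : Primrec derivMon := by
  refine Primrec.list_rec (f := fun l : List (ℕ × ℕ) => l) (g := fun _ => [])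
    (h := fun _ (p : (ℕ × ℕ) × List (ℕ × ℕ) × List (List (ℕ × ℕ))) =>
      ((p.1.1, p.1.2 + 1) :: p.2.1) :: p.2.2.map (p.1 :: ·)) Primrec.id (Primrec.const []) ?_
  refine Primrec.list_cons.comp ?_ ?_
  · refine Primrec.list_cons.comp (Primrec.pair ?_ (Primrec.succ.comp ?_)) ?_
    · exact Primrec.fst.comp (Primrec.fst.comp Primrec.snd)
    · exact Primrec.snd.comp (Primrec.fst.comp Primrec.snd)
    · exact Primrec.fst.comp (Primrec.snd.comp Primrec.snd)
  · refine Primrec.list_map (Primrec.snd.comp (Primrec.snd.comp Primrec.snd)) ?_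
    exact Primrec.list_cons.comp (Primrec.fst.comp (Primrec.snd.comp Primrec.fst)) Primrec.snd

theorem primrec_deriv : Primrec deriv := by
  refine Primrec.list_flatMap (f := fun c : Code => c)
    (g := fun _ t => (derivMon t.2).map fun l => (t.1, l)) Primrec.id ?_
  refine Primrec.list_map (primrec_derivMon.comp (Primrec.snd.comp Primrec.snd)) ?_
  exact Primrec.pair (Primrec.fst.comp (Primrec.snd.comp Primrec.fst)) Primrec.snd

theorem primrec_iterate_deriv : Primrec₂ fun (r : ℕ) (c : Code) => deriv^[r] c :=
  Primrec.nat_iterate Primrec.fst Primrec.snd (primrec_deriv.comp Primrec.snd)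

theorem primrec_subst : Primrec₂ subst := by
  refine Primrec.list_flatMap (f := fun p : List Code × Code => p.2)
    (g := fun p t => t.2.foldr (fun v acc => mul (p.1.getD v.1 []) acc) [(t.1, [])])
    Primrec.snd ?_
  refine Primrec.list_foldr
    (f := fun q : (List Code × Code) × (List ℕ × List (ℕ × ℕ)) => q.2.2)
    (g := fun q => [(q.2.1, [])])
    (h := fun q (u : (ℕ × ℕ) × Code) => mul (q.1.1.getD u.1.1 []) u.2) ?_ ?_ ?_
  · exact Primrec.snd.comp Primrec.snd
  · refine Primrec.list_cons.comp (Primrec.pair (Primrec.fst.comp Primrec.snd) ?_) ?_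
    · exact Primrec.const _
    · exact Primrec.const _
  · refine primrec_mul.comp ((Primrec.list_getD []).comp ?_ ?_) ?_
    · exact Primrec.fst.comp (Primrec.fst.comp Primrec.fst)
    · exact Primrec.fst.comp (Primrec.fst.comp Primrec.snd)
    · exact Primrec.snd.comp Primrec.snd

theorem primrec_horner : Primrec₂ horner := by
  refine Primrec.list_foldr (f := fun p : List Code × Code => p.1) (g := fun _ => [])
    (h := fun p (u : Code × Code) => u.1 ++ mul p.2 u.2) Primrec.fst (Primrec.const []) ?_
  exact Primrec.list_append.comp (Primrec.fst.comp Primrec.snd)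
    (primrec_mul.comp (Primrec.snd.comp Primrec.fst) (Primrec.snd.comp Primrec.snd))

theorem primrec_derivList : Primrec₂ derivList := by
  refine Primrec.list_flatMap (f := fun p : List Code × ℕ => p.1)
    (g := fun p g => (List.range p.2).map fun s => deriv^[s] g) Primrec.fst ?_
  refine Primrec.list_map (f := fun q : (List Code × ℕ) × Code => List.range q.1.2)
    (g := fun q s => deriv^[s] q.2)
    (Primrec.list_range.comp (Primrec.snd.comp Primrec.fst)) ?_
  exact primrec_iterate_deriv.comp Primrec.snd (Primrec.snd.comp Primrec.fst)

theorem primrec_var : Primrec var := by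
  refine Primrec.list_cons.comp (Primrec.pair (Primrec.const _)
    (Primrec.list_cons.comp (Primrec.pair Primrec.id (Primrec.const 0)) (Primrec.const [])))
    (Primrec.const [])

theorem primrec_ofRaw : Primrec ofRaw := by
  refine Primrec.list_map (f := fun c : List (ℕ × List (ℕ × ℕ)) => c)
    (g := fun _ t => ([t.1], t.2)) Primrec.id ?_
  exact Primrec.pair
    (Primrec.list_cons.comp (Primrec.fst.comp Primrec.snd) (Primrec.const []))
    (Primrec.snd.comp Primrec.snd)

/-- Over a constructive field it is decidable whether a code denotes zero. -/
theorem exists_isZeroTest {k : Type*} [Field k] {ν : ℕ → k} (hν : IsConstructivization ν) :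
    ∃ zero : Code → Bool, Computable zero ∧ IsZeroTest ν zero := by
  obtain ⟨s, hs, hsν⟩ := hν.add_computable
  obtain ⟨m, hm, hmν⟩ := hν.mul_computable
  obtain ⟨z, hz⟩ := hν.surjective 0
  obtain ⟨o, ho⟩ := hν.surjective 1
  obtain ⟨e, he, heν⟩ : ∃ e : ℕ × ℕ → Bool, Computable e ∧
      ∀ p, e p = true ↔ ν p.1 = ν p.2 := by
    obtain ⟨_, h⟩ := hν.eq_decidable
    exact ⟨_, h, fun p => decide_eq_true_iff⟩
  let P : List ℕ → ℕ := fun l => l.foldl m o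
  have hP : Computable P :=
    computable_list_foldl (f := fun l : List ℕ => l) (g := fun _ => o)
      (h := fun _ (p : ℕ × ℕ) => m p.1 p.2) Computable.id (Computable.const o)
      (hm.comp (Computable.fst.comp Computable.snd) (Computable.snd.comp Computable.snd))
  have hPν : ∀ l, ν (P l) = (l.map ν).prod := by
    have : ∀ (l : List ℕ) (a : ℕ), ν (l.foldl m a) = ν a * (l.map ν).prod := by
      intro l
      induction l with
      | nil => simp
      | cons b l ih => intro a; rw [List.foldl_cons, ih, hmν]; simp [mul_assoc]
    intro l
    rw [this, ho, one_mul]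
  obtain ⟨q, hq, hqp⟩ := exists_permTest (ℕ × ℕ)
  -- `T c l` is a number of the coefficient in `c` of the monomial with factors `l`; `z` and `o`
  -- number 0 and 1.
  let T : Code → List (ℕ × ℕ) → ℕ := fun c l =>
    c.foldl (fun a u => bif q (u.2, l) then s a (P u.1) else a) z
  have hT : Computable₂ T := by
    refine computable_list_foldl (f := fun p : Code × List (ℕ × ℕ) => p.1) (g := fun _ => z)
      (h := fun p (r : ℕ × (List ℕ × List (ℕ × ℕ))) =>
        bif q (r.2.2, p.2) then s r.1 (P r.2.1) else r.1)
      Computable.fst (Computable.const z) ?_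
    have h1 : Computable fun r : (Code × List (ℕ × ℕ)) × ℕ × (List ℕ × List (ℕ × ℕ)) =>
        q (r.2.2.2, r.1.2) :=
      hq.comp (Computable.pair
        (Computable.snd.comp (Computable.snd.comp Computable.snd))
        (Computable.snd.comp Computable.fst))
    have h2 : Computable fun r : (Code × List (ℕ × ℕ)) × ℕ × (List ℕ × List (ℕ × ℕ)) => r.2.1 :=
      Computable.fst.comp Computable.snd
    have h3 : Computable fun r : (Code × List (ℕ × ℕ)) × ℕ × (List ℕ × List (ℕ × ℕ)) => r.2.2.1 :=
      Computable.fst.comp (Computable.snd.comp Computable.snd)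
    exact Computable.cond h1 (hs.comp h2 (hP.comp h3)) h2
  have hTν : ∀ c l, ν (T c l) =
      (c.map fun u => if u.2.Perm l then (u.1.map ν).prod else 0).sum := by
    intro c l
    have : ∀ (c : Code) (a : ℕ),
        ν (c.foldl (fun a u => bif q (u.2, l) then s a (P u.1) else a) a) =
          ν a + (c.map fun u => if u.2.Perm l then (u.1.map ν).prod else 0).sum := by
      intro c
      induction c with
      | nil => simp
      | cons u c ih =>
        intro a
        rw [List.foldl_cons, ih, List.map_cons, List.sum_cons]
        by_cases hu : u.2.Perm l
        · rw [(hqp (u.2, l)).2 hu, cond_true, if_pos hu, hsν, hPν, add_assoc]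
        · rw [Bool.eq_false_iff.2 (mt (hqp (u.2, l)).1 hu), cond_false, if_neg hu, zero_add]
    rw [this, hz, zero_add]
  refine ⟨fun c => c.all fun t => e (T c t.2, z), ?_, fun c => ?_⟩
  · refine computable_list_all (f := fun c : Code => c)
      (q := fun c t => e (T c t.2, z)) Computable.id ?_
    exact he.comp (Computable.pair (hT.comp Computable.fst
      (Computable.snd.comp Computable.snd)) (Computable.const z))
  · rw [List.all_eq_true, val_eq_zero_iff]
    simp only [heν, hTν, hz]

variable {zero : Code → Bool}

theorem computable_algCheck (hz : Computable zero) :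
    Computable fun p : Code × List Code × List Code => algCheck zero p.1 p.2.1 p.2.2 := by
  refine Primrec.and.to_comp.comp (hz.comp (Primrec.to_comp ?_)) (computable_list_any ?_ ?_)
  · refine primrec_horner.comp (Primrec.list_map ?_ ?_) Primrec.fst
    · exact Primrec.snd.comp Primrec.snd
    · exact primrec_subst.comp (Primrec.fst.comp (Primrec.snd.comp Primrec.fst)) Primrec.snd
  · exact Computable.snd.comp Computable.snd
  · exact Primrec.not.to_comp.comp (hz.comp (primrec_subst.to_comp.comp
      (Computable.fst.comp (Computable.snd.comp Computable.fst)) Computable.snd))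

theorem computable_dAlgCheck (hz : Computable zero) :
    Computable fun p : Code × List Code × (ℕ × ℕ × List Code) =>
      dAlgCheck zero p.1 p.2.1 p.2.2 := by
  have h1 : Primrec fun p : Code × List Code × (ℕ × ℕ × List Code) => p.2.2.1 :=
    Primrec.fst.comp (Primrec.snd.comp Primrec.snd)
  have h2 : Primrec fun p : Code × List Code × (ℕ × ℕ × List Code) => p.2.2.2.1 :=
    Primrec.fst.comp (Primrec.snd.comp (Primrec.snd.comp Primrec.snd))
  have h3 : Primrec fun p : Code × List Code × (ℕ × ℕ × List Code) => p.2.2.2.2 :=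
    Primrec.snd.comp (Primrec.snd.comp (Primrec.snd.comp Primrec.snd))
  have h4 : Primrec fun p : Code × List Code × (ℕ × ℕ × List Code) => p.2.1 :=
    Primrec.fst.comp Primrec.snd
  have h5 : Primrec fun p : Code × List Code × (ℕ × ℕ × List Code) => [p.1] :=
    Primrec.list_cons.comp Primrec.fst (Primrec.const [])
  have h6 : Primrec fun p : Code × List Code × (ℕ × ℕ × List Code) => deriv^[p.2.2.1] p.1 :=
    primrec_iterate_deriv.comp h1 Primrec.fst
  have h7 : Primrec fun p : Code × List Code × (ℕ × ℕ × List Code) =>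
      derivList [p.1] p.2.2.1 ++ derivList p.2.1 p.2.2.2.1 :=
    Primrec.list_append.comp (primrec_derivList.comp h5 h1) (primrec_derivList.comp h4 h2)
  simp only [dAlgCheck]
  have h8 := (computable_algCheck hz).comp (h6.to_comp.pair (h7.to_comp.pair h3.to_comp))
  beta_reduce at h8
  with_reducible exact h8

theorem computable_depCheck (hz : Computable zero) : Computable₂ (depCheck zero) := by
  have h1 : Primrec fun p : List Code × (ℕ × ℕ × ℕ × List Code) => p.2.1 :=
    Primrec.fst.comp Primrec.snd
  have h2 : Primrec fun p : List Code × (ℕ × ℕ × ℕ × List Code) => p.2.2 :=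
    Primrec.snd.comp Primrec.snd
  have h3 : Primrec fun p : List Code × (ℕ × ℕ × ℕ × List Code) => decide (p.2.1 < p.1.length) :=
    Primrec.nat_lt.decide.comp h1 (Primrec.list_length.comp Primrec.fst)
  have h4 : Primrec fun p : List Code × (ℕ × ℕ × ℕ × List Code) => p.1.getD p.2.1 [] :=
    (Primrec.list_getD []).comp Primrec.fst h1
  have h5 : Primrec fun p : List Code × (ℕ × ℕ × ℕ × List Code) => p.1.drop (p.2.1 + 1) :=
    Primrec.list_drop.comp (Primrec.succ.comp h1) Primrec.fst
  have h6 : Computable fun p : List Code × (ℕ × ℕ × ℕ × List Code) =>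
      dAlgCheck zero (p.1.getD p.2.1 []) (p.1.drop (p.2.1 + 1)) p.2.2 := by
    have h := (computable_dAlgCheck hz).comp (h4.to_comp.pair (h5.to_comp.pair h2.to_comp))
    beta_reduce at h
    with_reducible exact h
  have h7 := Primrec.and.to_comp.comp h3.to_comp h6
  have h8 : Computable fun p : List Code × (ℕ × ℕ × ℕ × List Code) => depCheck zero p.1 p.2 := by
    simp only [depCheck]
    with_reducible exact h7
  exact h8

theorem computable_indepCheck (hz : Computable zero) : Computable₂ (indepCheck zero) := by
  have h1 : Primrec fun p : List Code × (ℕ × List ℕ × List (ℕ × ℕ × List Code)) => p.2.1 :=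
    Primrec.fst.comp Primrec.snd
  have h2 : Primrec fun p : List Code × (ℕ × List ℕ × List (ℕ × ℕ × List Code)) => p.2.2.1 :=
    Primrec.fst.comp (Primrec.snd.comp Primrec.snd)
  have h3 : Primrec fun p : List Code × (ℕ × List ℕ × List (ℕ × ℕ × List Code)) => p.2.2.2 :=
    Primrec.snd.comp (Primrec.snd.comp Primrec.snd)
  have h4 : Primrec fun p : List Code × (ℕ × List ℕ × List (ℕ × ℕ × List Code)) =>
      decide (p.2.2.1.length + p.1.length ≤ p.2.1) :=
    Primrec.nat_le.decide.comp (Primrec.nat_add.comp (Primrec.list_length.comp h2)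
      (Primrec.list_length.comp Primrec.fst)) h1
  have h5 : Primrec fun p : List Code × (ℕ × List ℕ × List (ℕ × ℕ × List Code)) =>
      p.2.2.1.map var ++ p.1 :=
    Primrec.list_append.comp (Primrec.list_map h2 (primrec_var.comp Primrec.snd)) Primrec.fst
  have h6 : Primrec fun q : (List Code × (ℕ × List ℕ × List (ℕ × ℕ × List Code))) × ℕ =>
      q.1.2.2.2.getD q.2 (0, 0, []) :=
    (Primrec.list_getD (0, 0, [])).comp (h3.comp Primrec.fst) Primrec.snd
  have h7 : Primrec fun q : (List Code × (ℕ × List ℕ × List (ℕ × ℕ × List Code))) × ℕ =>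
      var q.2 := primrec_var.comp Primrec.snd
  have h8 : Primrec fun p : List Code × (ℕ × List ℕ × List (ℕ × ℕ × List Code)) =>
      List.range p.2.1 := Primrec.list_range.comp h1
  have h9 : Computable fun q : (List Code × (ℕ × List ℕ × List (ℕ × ℕ × List Code))) × ℕ =>
      dAlgCheck zero (var q.2) (q.1.2.2.1.map var ++ q.1.1) (q.1.2.2.2.getD q.2 (0, 0, [])) := by
    have h := (computable_dAlgCheck hz).comp
      (h7.to_comp.pair ((h5.comp Primrec.fst).to_comp.pair h6.to_comp))
    beta_reduce at h
    with_reducible exact h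
  have h10 : Computable₂
      fun (p : List Code × (ℕ × List ℕ × List (ℕ × ℕ × List Code))) (j : ℕ) =>
        dAlgCheck zero (var j) (p.2.2.1.map var ++ p.1) (p.2.2.2.getD j (0, 0, [])) := by
    unfold Computable₂
    with_reducible exact h9
  have h11 := Primrec.and.to_comp.comp h4.to_comp (computable_list_all h8.to_comp h10)
  have h12 : Computable fun p : List Code × (ℕ × List ℕ × List (ℕ × ℕ × List Code)) =>
      indepCheck zero p.1 p.2 := by
    simp only [indepCheck]
    with_reducible exact h11
  exact h12

/-- Differential dependence is decidable over a constructive field of characteristic zero. -/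
theorem computablePred_not_dIndep {k : Type*} [Field k] [CharZero k] {ν : ℕ → k}
    (hν : IsConstructivization ν) :
    ComputablePred fun l : List Code => ¬ DiffDim.DIndep (univD k) (l.map (val ν)) := by
  obtain ⟨zero, hc, hz⟩ := exists_isZeroTest hν
  -- Post's theorem: dependence and independence are each recursively enumerable, by search for
  -- their certificates.
  refine ComputablePred.computable_iff_re_compl_re'.2 ⟨?_, ?_⟩
  · exact (rePred_exists (computable_depCheck hc)).of_eq
      (exists_depCheck_iff hν.surjective hz)
  · exact (rePred_exists (computable_indepCheck hc)).of_eq fun l => by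
      rw [not_not]; exact exists_indepCheck_iff hν.surjective hz l

end Code

end Novikov
end

open Novikov in
/-- One algorithm `A` (for the given constructive field) takes `n` and a finite list of codes of
elements of the free Novikov algebra of rank `n`, and decides whether these are dependent. -/
theorem corollary2 {k : Type*} [Field k] [CharZero k] (ν : ℕ → k) (hν : IsConstructivization ν) :
    ∃ A : ℕ × List (List (ℕ × List (ℕ × ℕ))) → Bool, Computable A ∧
      ∀ (n : ℕ) (s : List (DiffCode n)), (∀ c ∈ s, DiffCode.value ν c ∈ freeNovikov k n) →
        (A (n, s.map DiffCode.raw) = true ↔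
          NovikovDependent fun j : Fin s.length => DiffCode.value ν (s.get j)) := by
  obtain ⟨hdec, hcomp⟩ := Code.computablePred_not_dIndep hν
  -- The algorithm ignores `n`: the embedding into countably many indeterminates preserves and
  -- reflects independence, so one procedure serves every rank.
  refine ⟨fun x => decide (¬ DiffDim.DIndep (univD k) ((x.2.map Code.ofRaw).map (Code.val ν))),
    hcomp.comp (Primrec.to_comp (Primrec.list_map Primrec.snd
      (Code.primrec_ofRaw.comp Primrec.snd))), fun n s hs => ?_⟩
  rw [decide_eq_true_iff, novikovDependent_iff _ fun j => hs _ (s.get_mem j),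
    ← DiffDim.dIndep_map_iff (D' := univD k) (emb k n) (emb_injective n) univD_emb]
  have : (List.ofFn fun j : Fin s.length => DiffCode.value ν (s.get j)).map (emb k n) =
      ((s.map DiffCode.raw).map Code.ofRaw).map (Code.val ν) := by
    refine List.ext_getElem (by simp) fun i _ _ => ?_
    simp [Code.val_ofRaw_raw]
  rw [this]
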